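/- All graphs are finite, undirected and simple. For a graph $G$, let $\delta(G)$ be its minimum degree, and let its edge-connectivity $\kappa'(G)$ be the minimum size of a set $U\subseteq E(G)$ such that $G-U$ is disconnected, with the convention $\kappa'(G)=1$ if $G$ has exactly one vertex. (The graph with no vertices is not regarded as connected.) The graph $G$ is $k$-edge-connected if $\kappa'(G)\ge k$. Theorem 4.4. Let $T$ be a tree of order $m$. 1. Every $2$-edge-connected graph $G$ with $\delta(G)\ge m+2$ contains a subtree $T'\cong T$ such that $\kappa'(G-V(T'))\ge 2$. 2. Every $3$-edge-connected graph $G$ with $\delta(G)\ge m+3$ contains a subtree $T'\cong T$ such that $\kappa'(G-V(T'))\ge 3$. -/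

import Mathlib

/-- The edge-connectivity of a finite graph `G`: the minimum size of a set `U` of edges of `G`
such that `G - U` is disconnected.  A graph with exactly one vertex has no such set `U`; its
edge-connectivity is `1` by convention.  (The graph with all edges deleted is disconnected as soon
as there are two vertices, so the infimum is over a nonempty set whenever there are at least two
vertices; the graph without vertices does not count as connected and gets the value `0`.) -/
noncomputable def SimpleGraph.edgeConnectivity {V : Type*} (G : SimpleGraph V) : ℕ :=
  open Classical in
  if Nat.card V = 1 then 1
  else sInf {n : ℕ | ∃ U : Finset (Sym2 V),
    (U : Set (Sym2 V)) ⊆ G.edgeSet ∧ ¬ (G.deleteEdges (U : Set (Sym2 V))).Connected ∧ U.card = n}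

/-- `G` is `k`-edge-connected if its edge-connectivity is at least `k`. -/
def SimpleGraph.IsKEdgeConnected {V : Type*} (G : SimpleGraph V) (k : ℕ) : Prop :=
  k ≤ G.edgeConnectivity

/-- The graph `G - V(H)`: the subgraph of `G` induced on the vertices outside the subgraph `H`. -/
abbrev SimpleGraph.minusVerts {V : Type*} (G : SimpleGraph V) (H : G.Subgraph) :
    SimpleGraph ↥(H.vertsᶜ) :=
  G.induce H.vertsᶜ

/-!
Let `k` be `2` or `3` and fix a vertex `r`.  A set `B` of vertices containing `r` is *admissible*
(`Admissible`) if `G[B]` has no cut with fewer than two edges and, for `k = 3`, the sets avoiding `r`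
which are cut off by two edges only, the *tight* sets, consist of vertices of degree two in `G[B]`.
For `k = 3`, `G[B]` is thus a subdivision of a `3`-edge-connected multigraph, and the tight sets are
the intervals of the subdivided edges.  Among the admissible sets `B` such that `V \ B` contains a
copy of the tree `T` of order `m` choose one with `G[B]` of largest cyclomatic number and, among
these, with as few vertices as possible (`Optimal`).  The claim is that for some optimal `B` the
complement is the vertex set of a copy of `T`.  Then all vertices of `G[B]` have degree at least
`k`, so no tight sets exist and `G[B]` is `k`-edge-connected.

Suppose that no optimal set is of this kind.  The embedding lemma `IsTree.exists_fitsIn_erase` says: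
if all vertices of `H` outside a nonempty set `X` have at least `m` neighbours in `H`, and a copy of
`T` in `H` does not cover `H`, then some copy of `T` in `H` avoids a vertex of `X`.  Applied to
`H = V \ B` and the set `X` of the vertices with more than `k` neighbours in `B`, it yields `X = ∅`:
a vertex `x` that is avoided could be added to `B`, or it would allow a shortcut of a subdivided
edge (`Optimal.exists_tight`, `Optimal.degIn_le`).  Hence all degrees in `G[V \ B]` are at least `m`,
and every vertex outside `B` can be avoided (`Stuck`).

As `G` is `k`-edge-connected, there is an *ear*: a path outside `B` whose ends have neighbours in
`B` that lie in no common tight set (`Stuck.exists_earPair`).  Take the optimal set and the ear so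
that the ear is as short as possible.  Adding the ear `P` to `B` gives an admissible set of larger
cyclomatic number (`Admissible.union_path`).  Every vertex outside `B ∪ P` has at most `k + 1`
neighbours in `B ∪ P`: a vertex `u` with three neighbours in `B` may be exchanged with the middle
one of them (`Stuck.swap`), and if it had neighbours far along `P` a shorter ear would result
(`Stuck.degIn_add_degIn_ear_le`).  So the complement of `B ∪ P` has minimum degree at least `m - 1`
and contains `T` by the greedy embedding, which contradicts the choice of `B`.
-/

/-! ### Greedy embeddings of rooted trees -/

namespace SimpleGraph

section Embedding

open scoped Classical

variable {V W : Type*} {G : SimpleGraph V} {T : SimpleGraph W}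

/-- The number of neighbours of `v` in the finite set `Y`. -/
noncomputable def degIn (G : SimpleGraph V) (Y : Finset V) (v : V) : ℕ :=
  (Y.filter (G.Adj v)).card

/-- `T.FitsIn G Y`: the graph `G` contains a (not necessarily induced) copy of `T` all of whose
vertices lie in `Y`. -/
def FitsIn (T : SimpleGraph W) (G : SimpleGraph V) (Y : Finset V) : Prop :=
  ∃ f : W → V, Function.Injective f ∧ (∀ a b, T.Adj a b → G.Adj (f a) (f b)) ∧ ∀ w, f w ∈ Y

lemma FitsIn.mono {Y Z : Finset V} (h : T.FitsIn G Y) (hYZ : Y ⊆ Z) : T.FitsIn G Z := by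
  obtain ⟨f, h1, h2, h3⟩ := h
  exact ⟨f, h1, h2, fun w => hYZ (h3 w)⟩

lemma degIn_mono {Y Z : Finset V} (h : Y ⊆ Z) (v : V) : G.degIn Y v ≤ G.degIn Z v :=
  Finset.card_le_card (Finset.filter_subset_filter _ h)

lemma degIn_le_card (Y : Finset V) (v : V) : G.degIn Y v ≤ Y.card :=
  Finset.card_filter_le _ _

lemma degIn_union {Y Z : Finset V} (h : Disjoint Y Z) (v : V) :
    G.degIn (Y ∪ Z) v = G.degIn Y v + G.degIn Z v := by
  unfold degIn
  rw [Finset.filter_union]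
  exact Finset.card_union_of_disjoint (Finset.disjoint_filter_filter h)

/-- A rooting of the tree `T`: a root together with the parent of every other vertex and a depth
function witnessing that passing to the parent terminates.  The root is its own parent. -/
structure Rooting (T : SimpleGraph W) where
  root : W
  par : W → W
  dep : W → ℕ
  par_root : par root = root
  dep_par : ∀ w, w ≠ root → dep (par w) < dep w
  adj_par : ∀ w, w ≠ root → T.Adj (par w) w
  eq_par : ∀ a b, T.Adj a b → (a ≠ root ∧ par a = b) ∨ (b ≠ root ∧ par b = a)

lemma Rooting.hom_of_adj_par (R : T.Rooting) {f : W → V}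
    (h : ∀ w, w ≠ R.root → G.Adj (f (R.par w)) (f w)) (a b : W) (hab : T.Adj a b) :
    G.Adj (f a) (f b) := by
  rcases R.eq_par a b hab with ⟨h1, h2⟩ | ⟨h1, h2⟩
  · have := h a h1
    rw [h2] at this
    exact this.symm
  · have := h b h1
    rwa [h2] at this

lemma IsTree.exists_rooting (hT : T.IsTree) (r : W) : ∃ R : T.Rooting, R.root = r := by
  have hc := hT.connected
  have key : ∀ w, w ≠ r → ∃ p, T.Adj p w ∧ T.dist p r < T.dist w r := by
    intro w hw
    obtain ⟨p, hp⟩ := hc.exists_walk_length_eq_dist w r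
    cases p with
    | nil => exact absurd rfl hw
    | cons h q =>
      refine ⟨_, h.symm, ?_⟩
      have := dist_le q
      simp only [Walk.length_cons] at hp
      omega
  -- the neighbour closer to the root is unique, since geodesics to the root are paths
  have uniq : ∀ a b c, T.Adj a b → T.Adj a c → T.dist b r < T.dist a r →
      T.dist c r < T.dist a r → b = c := by
    intro a b c hab hac hb hcr
    have path : ∀ x (hax : T.Adj a x), T.dist x r < T.dist a r →
        ∃ q : T.Walk x r, (Walk.cons hax q).IsPath := by
      intro x hax hx
      obtain ⟨q, hq⟩ := hc.exists_walk_length_eq_dist x r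
      refine ⟨q, Walk.isPath_of_length_eq_dist _ ?_⟩
      have h1 := dist_le (Walk.cons hax q)
      simp only [Walk.length_cons] at h1 ⊢
      omega
    obtain ⟨q1, h1⟩ := path b hab hb
    obtain ⟨q2, h2⟩ := path c hac hcr
    have := (hT.existsUnique_path a r).unique h1 h2
    have h3 := congrArg (fun p : T.Walk a r => p.snd) this
    simpa using h3
  let par : W → W := fun w => if h : w ≠ r then (key w h).choose else r
  have hpar : ∀ w, w ≠ r → T.Adj (par w) w ∧ T.dist (par w) r < T.dist w r := by
    intro w hw
    simp only [par, dif_pos hw]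
    exact (key w hw).choose_spec
  have heq : ∀ a b, T.Adj a b → T.dist b r < T.dist a r → a ≠ r ∧ par a = b := by
    intro a b hab hlt
    have ha : a ≠ r := by
      rintro rfl
      simp at hlt
    exact ⟨ha, uniq a _ _ (hpar a ha).1.symm hab (hpar a ha).2 hlt⟩
  refine ⟨⟨r, par, fun w => T.dist w r, by simp [par], fun w hw => (hpar w hw).2,
    fun w hw => (hpar w hw).1, ?_⟩, rfl⟩
  intro a b hab
  have hne : T.dist a r ≠ T.dist b r := by
    rw [dist_comm, dist_comm (u := b)]
    exact hT.dist_ne_of_adj r hab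
  rcases lt_or_gt_of_ne hne with h | h
  · exact Or.inr (heq b a hab.symm h)
  · exact Or.inl (heq a b hab h)

/-- Greedy extension of a partial embedding `g`, defined on `A`, by the vertices in `L`, all of
which are placed in `Y`.  A vertex can always be placed as long as the image of its parent has more
neighbours in `Y` than there are other vertices of the tree which end up in `Y`. -/
lemma Rooting.extend (R : T.Rooting) (Y : Finset V) (n : ℕ) :
    ∀ (g : W → V) (A L : Finset W), L.card = n → Disjoint A L → R.root ∉ L →
    (∀ v ∈ L, R.par v ∈ A ∪ L) → Set.InjOn g A →
    (∀ v ∈ L, R.par v ∈ A → (A.filter (fun a => g a ∈ Y)).card + L.card ≤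
      G.degIn Y (g (R.par v)) + if g (R.par v) ∈ Y then 1 else 0) →
    (∀ v ∈ L, R.par v ∈ L → ∀ y ∈ Y,
      (A.filter (fun a => g a ∈ Y)).card + L.card ≤ G.degIn Y y + 1) →
    ∃ g' : W → V, (∀ a ∈ A, g' a = g a) ∧ Set.InjOn g' (A ∪ L : Finset W) ∧
      ∀ v ∈ L, g' v ∈ Y ∧ G.Adj (g' (R.par v)) (g' v) := by
  induction n with
  | zero =>
    intro g A L hL _ _ _ hinj _ _
    obtain rfl := Finset.card_eq_zero.mp hL
    exact ⟨g, fun _ _ => rfl, by simpa using hinj, by simp⟩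
  | succ n ih =>
    intro g A L hL hAL hroot hpar hinj hA hLY
    have hne : L.Nonempty := Finset.card_pos.mp (by omega)
    obtain ⟨v, hv, hmin⟩ := Finset.exists_min_image L R.dep hne
    have hvr : v ≠ R.root := fun h => hroot (h ▸ hv)
    have hpA : R.par v ∈ A := by
      rcases Finset.mem_union.mp (hpar v hv) with h | h
      · exact h
      · exact absurd (hmin _ h) (not_le.mpr (R.dep_par v hvr))
    have hvA : v ∉ A := fun h => Finset.disjoint_left.mp hAL h hv
    obtain ⟨y, hyY, hyadj, hynew⟩ : ∃ y ∈ Y, G.Adj (g (R.par v)) y ∧ ∀ a ∈ A, g a ≠ y := by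
      by_contra hcon
      push Not at hcon
      set p := g (R.par v) with hp
      set U := A.filter (fun a => g a ∈ Y) with hU
      have hsub : Y.filter (G.Adj p) ⊆ (U.image g).erase p := by
        intro y hy
        rw [Finset.mem_filter] at hy
        obtain ⟨a, ha, hay⟩ := hcon y hy.1 hy.2
        refine Finset.mem_erase.mpr ⟨fun h => ?_, ?_⟩
        · rw [h] at hy
          exact G.loopless.irrefl _ hy.2
        · exact Finset.mem_image.mpr ⟨a, by simp [hU, ha, hay, hy.1], hay⟩
      have h1 : G.degIn Y p ≤ ((U.image g).erase p).card := Finset.card_le_card hsub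
      have h2 : (U.image g).card ≤ U.card := Finset.card_image_le
      have h3 := hA v hv hpA
      rw [← hp] at h3
      by_cases hpY : p ∈ Y
      · have : p ∈ U.image g := Finset.mem_image.mpr ⟨_, by simp [hU, hpA, hpY, ← hp], rfl⟩
        rw [Finset.card_erase_of_mem this] at h1
        have : 0 < (U.image g).card := Finset.card_pos.mpr ⟨_, this⟩
        rw [if_pos hpY] at h3
        omega
      · have := Finset.card_erase_le (a := p) (s := U.image g)
        rw [if_neg hpY] at h3
        omega
    have hg1 : ∀ a ∈ A, Function.update g v y a = g a := fun a ha =>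
      Function.update_of_ne (fun h : a = v => hvA (h ▸ ha)) _ _
    have hfil : ((insert v A).filter (fun a => Function.update g v y a ∈ Y)) =
        insert v (A.filter (fun a => g a ∈ Y)) := by
      rw [Finset.filter_insert, if_pos (by simpa using hyY)]
      congr 1
      exact Finset.filter_congr fun a ha => by rw [hg1 a ha]
    have hcard : ((insert v A).filter (fun a => Function.update g v y a ∈ Y)).card +
        (L.erase v).card = (A.filter (fun a => g a ∈ Y)).card + L.card := by
      rw [hfil, Finset.card_insert_of_notMem (by simp [hvA]), Finset.card_erase_of_mem hv]
      omega
    have hun : insert v A ∪ L.erase v = A ∪ L := by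
      ext a
      simp only [Finset.mem_union, Finset.mem_insert, Finset.mem_erase]
      by_cases h : a = v
      · simp [h, hv]
      · simp [h]
    obtain ⟨g', h1, h2, h3⟩ := ih (Function.update g v y) (insert v A) (L.erase v)
      (by rw [Finset.card_erase_of_mem hv]; omega)
      (by
        rw [Finset.disjoint_insert_left]
        exact ⟨by simp, hAL.mono_right (Finset.erase_subset _ _)⟩)
      (fun h => hroot (Finset.mem_of_mem_erase h))
      (fun u hu => hun ▸ hpar u (Finset.mem_of_mem_erase hu))
      (by
        intro a ha b hb hab
        simp only [Finset.coe_insert, Set.mem_insert_iff, Finset.mem_coe] at ha hb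
        rcases ha with rfl | ha <;> rcases hb with rfl | hb
        · rfl
        · rw [hg1 b hb, Function.update_self] at hab
          exact absurd hab.symm (hynew b hb)
        · rw [hg1 a ha, Function.update_self] at hab
          exact absurd hab (hynew a ha)
        · rw [hg1 a ha, hg1 b hb] at hab
          exact hinj ha hb hab)
      (by
        intro u hu hpu
        rw [hcard]
        rcases Finset.mem_insert.mp hpu with h | h
        · rw [h, Function.update_self, if_pos hyY]
          exact hLY u (Finset.mem_of_mem_erase hu) (h ▸ hv) y hyY
        · rw [hg1 _ h]
          exact hA u (Finset.mem_of_mem_erase hu) h)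
      (by
        intro u hu hpu z hz
        rw [hcard]
        exact hLY u (Finset.mem_of_mem_erase hu) (Finset.mem_of_mem_erase hpu) z hz)
    refine ⟨g', fun a ha => ?_, hun ▸ h2, fun u hu => ?_⟩
    · rw [h1 a (Finset.mem_insert_of_mem ha), hg1 a ha]
    · by_cases huv : u = v
      · subst huv
        rw [h1 u (Finset.mem_insert_self _ _), Function.update_self,
          h1 _ (Finset.mem_insert_of_mem hpA), hg1 _ hpA]
        exact ⟨hyY, hyadj⟩
      · exact h3 u (Finset.mem_erase.mpr ⟨huv, hu⟩)

/-- A nonempty set in which every vertex has at least `|T| - 1` neighbours contains every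
tree `T`. -/
lemma IsTree.fitsIn_of_degIn [Fintype W] (hT : T.IsTree) {Y : Finset V} (hY : Y.Nonempty)
    (hdeg : ∀ y ∈ Y, Fintype.card W ≤ G.degIn Y y + 1) : T.FitsIn G Y := by
  obtain ⟨r⟩ := hT.connected.nonempty
  obtain ⟨R, rfl⟩ := hT.exists_rooting r
  obtain ⟨c, hc⟩ := hY
  have hU : (({R.root} : Finset W).filter (fun _ => c ∈ Y)).card +
      (Finset.univ.erase R.root).card = Fintype.card W := by
    rw [Finset.filter_true_of_mem (by simpa using hc), Finset.card_singleton,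
      Finset.card_erase_of_mem (Finset.mem_univ _), Finset.card_univ]
    have := Fintype.card_pos_iff.mpr ⟨R.root⟩
    omega
  obtain ⟨g, h1, h2, h3⟩ := R.extend (G := G) Y _ (fun _ => c) {R.root} (Finset.univ.erase R.root)
    rfl (by simp) (by simp) (fun v _ => by simp) (by simp)
    (fun v _ _ => by rw [hU, if_pos hc]; exact hdeg c hc)
    (fun v _ _ y hy => by rw [hU]; exact hdeg y hy)
  refine ⟨g, ?_, R.hom_of_adj_par fun w hw => (h3 w (by simp [hw])).2, fun w => ?_⟩
  · intro a b hab
    exact h2 (by simp) (by simp) hab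
  · by_cases hw : w = R.root
    · rw [hw, h1 _ (by simp)]
      exact hc
    · exact (h3 w (by simp [hw])).1

end Embedding

end SimpleGraph

/-! ### Copies of a tree avoiding a vertex of a given set -/

namespace SimpleGraph

section Avoiding

open scoped Classical

variable {V W : Type*} {G : SimpleGraph V} {T : SimpleGraph W}

namespace Rooting

variable (R : T.Rooting)

/-- `R.Anc a v`: the vertex `a` is an ancestor of `v`, or `v` itself. -/
def Anc (a v : W) : Prop := ∃ n, R.par^[n] v = a

variable {R}

lemma Anc.refl (v : W) : R.Anc v v := ⟨0, rfl⟩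

lemma anc_par (v : W) : R.Anc (R.par v) v := ⟨1, rfl⟩

lemma Anc.trans {a b c : W} (h1 : R.Anc a b) (h2 : R.Anc b c) : R.Anc a c := by
  obtain ⟨i, rfl⟩ := h1
  obtain ⟨j, rfl⟩ := h2
  exact ⟨i + j, by rw [Function.iterate_add_apply]⟩

lemma Anc.of_par {a v : W} (h : R.Anc a (R.par v)) : R.Anc a v := h.trans (anc_par v)

lemma Anc.par_of_ne {a v : W} (h : R.Anc a v) (hne : v ≠ a) : R.Anc a (R.par v) := by
  obtain ⟨n, hn⟩ := h
  cases n with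
  | zero => exact absurd hn hne
  | succ n => exact ⟨n, by rwa [Function.iterate_succ_apply] at hn⟩

lemma anc_root (v : W) : R.Anc R.root v := by
  induction h : R.dep v using Nat.strong_induction_on generalizing v with
  | _ n ih =>
    by_cases hv : v = R.root
    · rw [hv]
      exact Anc.refl _
    · exact (ih _ (h ▸ R.dep_par v hv) _ rfl).of_par

lemma par_iterate_root (n : ℕ) : R.par^[n] R.root = R.root :=
  Function.iterate_fixed R.par_root n

lemma Anc.dep_lt {a v : W} (h : R.Anc a v) (hne : v ≠ a) : R.dep a < R.dep v := by
  obtain ⟨n, hn⟩ := h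
  induction n generalizing v with
  | zero => exact absurd hn hne
  | succ n ih =>
    have hv : v ≠ R.root := by
      rintro rfl
      rw [par_iterate_root] at hn
      exact hne hn
    rw [Function.iterate_succ_apply] at hn
    by_cases h : R.par v = a
    · exact h ▸ R.dep_par v hv
    · exact (ih h hn).trans (R.dep_par v hv)

lemma Anc.total {a b v : W} (ha : R.Anc a v) (hb : R.Anc b v) : R.Anc a b ∨ R.Anc b a := by
  obtain ⟨i, rfl⟩ := ha
  obtain ⟨j, rfl⟩ := hb
  rcases le_total i j with h | h
  · exact Or.inr ⟨j - i, by rw [← Function.iterate_add_apply, Nat.sub_add_cancel h]⟩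
  · exact Or.inl ⟨i - j, by rw [← Function.iterate_add_apply, Nat.sub_add_cancel h]⟩

variable [Fintype W]

lemma exists_leaf_below (v : W) : ∃ l, R.Anc v l ∧ ∀ w, w ≠ R.root → R.par w ≠ l := by
  obtain ⟨l, hl, hmax⟩ := Finset.exists_max_image (Finset.univ.filter (R.Anc v)) R.dep
    ⟨v, by simpa using Anc.refl v⟩
  simp only [Finset.mem_filter, Finset.mem_univ, true_and] at hl hmax
  refine ⟨l, hl, fun w hw h => ?_⟩
  have h1 := hmax w (Anc.of_par (h ▸ hl))
  have h2 := R.dep_par w hw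
  rw [h] at h2
  omega

/-- If `S` is closed under parents within the branch at `q`, then the vertices by which the branch
leaves `S` form an antichain, so there are at most as many of them as there are childless vertices
in the branch. -/
lemma card_exits_le_card_leaves (q : W) (S : Finset W)
    (hS : ∀ v ∈ S, R.Anc q v → v ≠ q → R.par v ∈ S) :
    (Finset.univ.filter fun v => R.Anc q v ∧ v ∉ S ∧ (v = q ∨ R.par v ∈ S)).card ≤
      (Finset.univ.filter fun l => R.Anc q l ∧ ∀ w, w ≠ R.root → R.par w ≠ l).card := by
  choose lf hlf using fun v => exists_leaf_below (R := R) v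
  have key : ∀ a b, R.Anc q a → R.Anc q b → a ∉ S → (b = q ∨ R.par b ∈ S) → R.Anc a b →
      a = b := by
    intro a b hqa hqb haS hb hab
    by_contra hne
    have hbq : b ≠ q := by
      rintro rfl
      exact absurd (hab.dep_lt (Ne.symm hne)) (not_lt.mpr (by
        by_cases h : a = b
        · rw [h]
        · exact (hqa.dep_lt h).le))
    have hpar : R.par b ∈ S := hb.resolve_left hbq
    obtain ⟨n, hn⟩ := hab.par_of_ne (Ne.symm hne)
    have hdown : ∀ n c, c ∈ S → R.Anc q c → R.par^[n] c = a → a ∈ S := by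
      intro n
      induction n with
      | zero =>
        rintro c hc _ rfl
        exact hc
      | succ n ih =>
        intro c hc hqc h
        rw [Function.iterate_succ_apply] at h
        by_cases hcq : c = q
        · subst hcq
          -- then `a` and `c` are ancestors of each other
          have h1 : R.Anc a c := ⟨n + 1, by rwa [Function.iterate_succ_apply]⟩
          by_cases hac : a = c
          · exact hac ▸ hc
          · exact absurd (h1.dep_lt (Ne.symm hac)) (not_lt.mpr (hqa.dep_lt hac).le)
        · exact ih _ (hS c hc hqc hcq) (hqc.par_of_ne hcq) h
    exact haS (hdown n _ hpar (hqb.par_of_ne hbq) hn)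
  refine Finset.card_le_card_of_injOn lf ?_ ?_
  · intro v hv
    simp only [Finset.coe_filter, Finset.mem_univ, true_and, Set.mem_ofPred_eq] at hv ⊢
    exact ⟨hv.1.trans (hlf v).1, (hlf v).2⟩
  · intro a ha b hb hab
    simp only [Finset.coe_filter, Finset.mem_univ, true_and, Set.mem_ofPred_eq] at ha hb
    have h1 := (hlf a).1
    rw [hab] at h1
    rcases h1.total (hlf b).1 with h | h
    · exact key a b ha.1 hb.1 ha.2.1 hb.2.2 h
    · exact (key b a hb.1 ha.1 hb.2.1 ha.2.2 h).symm

/-- The inequalities between the sizes of the parts of the tree which are needed to embed them one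
after the other.  Here `S ⊆ K`, the vertices of `K` properly below `q` have their parents in `S`,
and the parts are: the vertices outside the branch at `q` which lie in `K`, which are children of
`S`, which are children of `K \ S`, the remaining ones; and in the branch at `q`, without `q`,
those with and those without children. -/
lemma card_parts (q : W) (K S : Finset W) (hSK : S ⊆ K)
    (hbelow : ∀ v ∈ K, R.Anc q v → v ≠ q → R.par v ∈ S) {Ko So Io Lo Li Lf : Finset W}
    (hKo : Ko = Finset.univ.filter (fun w => ¬ R.Anc q w ∧ w ∈ K))
    (hSo : So = Finset.univ.filter (fun w => ¬ R.Anc q w ∧ w ∉ K ∧ R.par w ∈ S))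
    (hIo : Io = Finset.univ.filter
      (fun w => ¬ R.Anc q w ∧ w ∉ K ∧ R.par w ∉ S ∧ R.par w ∈ K))
    (hLo : Lo = Finset.univ.filter (fun w => ¬ R.Anc q w ∧ w ∉ K ∧ R.par w ∉ K))
    (hLi : Li = Finset.univ.filter
      (fun w => R.Anc q w ∧ w ≠ q ∧ ∃ u, u ≠ R.root ∧ R.par u = w))
    (hLf : Lf = Finset.univ.filter
      (fun w => R.Anc q w ∧ w ≠ q ∧ ∀ u, u ≠ R.root → R.par u ≠ w)) :
    Ko.card + So.card + (Io.card + 1) + Lo.card + Li.card + Lf.card = Fintype.card W ∧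
    Io.card + Lo.card + K.card + (Finset.univ.filter fun s => s ∉ K ∧ R.par s ∈ S).card ≤
      Fintype.card W ∧
    Io.card + Lo.card + Li.card + (K \ S).card +
      (Finset.univ.filter fun s => s ∉ K ∧ R.par s ∈ S).card ≤ Fintype.card W := by
  set Kq := Finset.univ.filter (fun w => R.Anc q w ∧ w ∈ K) with hKq
  set KqS := Finset.univ.filter (fun w => R.Anc q w ∧ w ∈ K ∧ w ∉ S) with hKqS
  set Sq := Finset.univ.filter (fun w => R.Anc q w ∧ w ∉ K ∧ R.par w ∈ S) with hSq
  set Tq := Finset.univ.filter (fun w => R.Anc q w) with hTq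
  have c1 : Ko.card + So.card + Io.card + Lo.card + Tq.card = Fintype.card W := by
    have h0 : Fintype.card W = ∑ _w : W, 1 := by simp
    rw [h0]
    simp only [hKo, hSo, hIo, hLo, hTq, Finset.card_filter, ← Finset.sum_add_distrib]
    refine Finset.sum_congr rfl fun w _ => ?_
    have := @hSK (R.par w)
    by_cases h1 : R.Anc q w <;> by_cases h2 : w ∈ K <;> by_cases h3 : R.par w ∈ S <;>
      by_cases h4 : R.par w ∈ K <;> first | exact absurd (this h3) h4 | simp [h1, h2, h3, h4]
  have c2 : Tq.card = 1 + Li.card + Lf.card := by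
    have h0 : (Finset.univ.filter (fun w => w = q)).card = 1 := by
      rw [Finset.filter_eq' Finset.univ q]
      simp
    rw [← h0]
    simp only [hTq, hLi, hLf, Finset.card_filter, ← Finset.sum_add_distrib]
    refine Finset.sum_congr rfl fun w _ => ?_
    by_cases h : w = q
    · subst h
      simp [Rooting.Anc.refl]
    · by_cases h1 : R.Anc q w <;> by_cases h2 : ∃ u, u ≠ R.root ∧ R.par u = w
      · have h3 : ¬ ∀ u, u ≠ R.root → R.par u ≠ w := by push Not; exact h2
        rw [if_pos h1, if_neg h, if_pos ⟨h1, h, h2⟩, if_neg (by tauto)]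
      · have h3 : ∀ u, u ≠ R.root → R.par u ≠ w := by push Not at h2; exact h2
        rw [if_pos h1, if_neg h, if_neg (by tauto), if_pos ⟨h1, h, h3⟩]
      · simp [h, h1]
      · simp [h, h1]
  have c3 : (Finset.univ.filter fun s => s ∉ K ∧ R.par s ∈ S).card = So.card + Sq.card := by
    simp only [hSo, hSq, Finset.card_filter, ← Finset.sum_add_distrib]
    refine Finset.sum_congr rfl fun w _ => ?_
    by_cases h1 : R.Anc q w <;> simp [h1]
  have c4 : K.card = Ko.card + Kq.card := by
    have : K = Finset.univ.filter (fun w => w ∈ K) := by simp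
    rw [this]
    simp only [hKo, hKq, Finset.card_filter, ← Finset.sum_add_distrib]
    refine Finset.sum_congr rfl fun w _ => ?_
    by_cases h1 : R.Anc q w <;> simp [h1]
  have c5 : (K \ S).card ≤ Ko.card + KqS.card := by
    refine (Finset.card_le_card (t := Ko ∪ KqS) ?_).trans (Finset.card_union_le _ _)
    intro w hw
    rw [Finset.mem_sdiff] at hw
    simp only [hKo, hKqS, Finset.mem_union, Finset.mem_filter, Finset.mem_univ, true_and]
    tauto
  have c6 : KqS.card + Sq.card ≤ Lf.card + 1 := by
    have h1 := Rooting.card_exits_le_card_leaves (R := R) q S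
      (fun v hv hqv hne => hbelow v (hSK hv) hqv hne)
    have h2 : (KqS ∪ Sq).card = KqS.card + Sq.card := by
      refine Finset.card_union_of_disjoint (Finset.disjoint_left.mpr fun w hw hw' => ?_)
      simp only [hKqS, hSq, Finset.mem_filter, Finset.mem_univ, true_and] at hw hw'
      exact hw'.2.1 hw.2.1
    have h3 : KqS ∪ Sq ⊆ Finset.univ.filter
        (fun v => R.Anc q v ∧ v ∉ S ∧ (v = q ∨ R.par v ∈ S)) := by
      intro w hw
      simp only [hKqS, hSq, Finset.mem_union, Finset.mem_filter, Finset.mem_univ,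
        true_and] at hw ⊢
      rcases hw with hw | hw
      · exact ⟨hw.1, hw.2.2, or_iff_not_imp_left.mpr (hbelow w hw.2.1 hw.1)⟩
      · exact ⟨hw.1, fun h => hw.2.1 (hSK h), Or.inr hw.2.2⟩
    have h4 : (Finset.univ.filter fun l => R.Anc q l ∧ ∀ w, w ≠ R.root → R.par w ≠ l) ⊆
        insert q Lf := by
      intro w hw
      simp only [hLf, Finset.mem_insert, Finset.mem_filter, Finset.mem_univ, true_and] at hw ⊢
      tauto
    have h5 := Finset.card_le_card h3
    have h6 := Finset.card_le_card h4
    have h7 := Finset.card_insert_le q Lf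
    omega
  have c7 : Kq.card + Sq.card ≤ Tq.card := by
    rw [← Finset.card_union_of_disjoint (Finset.disjoint_left.mpr fun w hw hw' => by
      simp only [hKq, hSq, Finset.mem_filter, Finset.mem_univ, true_and] at hw hw'
      exact hw'.2.1 hw.2)]
    refine Finset.card_le_card fun w hw => ?_
    simp only [hKq, hSq, hTq, Finset.mem_union, Finset.mem_filter, Finset.mem_univ,
      true_and] at hw ⊢
    tauto
  have c8 : KqS.card ≤ Kq.card := by
    refine Finset.card_le_card fun w hw => ?_
    simp only [hKq, hKqS, Finset.mem_filter, Finset.mem_univ, true_and] at hw ⊢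
    tauto
  refine ⟨?_, ?_, ?_⟩ <;> omega

end Rooting

/-- Hall's theorem for a family of finite sets indexed by a finite set. -/
lemma exists_injOn_of_hall {ι α : Type*} [Nonempty α] (I : Finset ι) (t : ι → Finset α)
    (h : ∀ A ⊆ I, A.card ≤ (A.biUnion t).card) :
    ∃ g : ι → α, Set.InjOn g I ∧ ∀ i ∈ I, g i ∈ t i := by
  have := (Finset.all_card_le_biUnion_card_iff_exists_injective (fun i : I => t i)).mp (by
    intro s
    have h1 := h (s.map (Function.Embedding.subtype _)) (by
      intro i hi
      obtain ⟨j, -, rfl⟩ := Finset.mem_map.mp hi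
      exact j.2)
    rw [Finset.card_map] at h1
    refine h1.trans (Finset.card_le_card ?_)
    intro a ha
    simp only [Finset.mem_biUnion, Finset.mem_map, Function.Embedding.coe_subtype] at ha ⊢
    obtain ⟨_, ⟨j, hj, rfl⟩, ha⟩ := ha
    exact ⟨j, hj, ha⟩)
  obtain ⟨g, hg, hgt⟩ := this
  refine ⟨fun i => if hi : i ∈ I then g ⟨i, hi⟩ else Classical.arbitrary α, ?_, ?_⟩
  · intro i hi j hj hij
    simp only [Finset.mem_coe] at hi hj
    simp only [dif_pos hi, dif_pos hj] at hij
    exact congrArg Subtype.val (hg hij)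
  · intro i hi
    simpa only [dif_pos hi] using hgt ⟨i, hi⟩

variable [Fintype W]

set_option maxHeartbeats 2000000 in
/-- If `H` contains a copy `f` of `T` and a further vertex, and every vertex of `H` outside `X` has
at least `|T|` neighbours in `H`, then some copy of `T` in `H` avoids a vertex of `X`.

Suppose that `X` lies in the image of `f`, let `K` be the subtree spanned by the preimage of `X`
and a root in that preimage, and let `S ⊆ K` be a largest set with no more neighbours outside
`f '' K` than it has children outside `K`.  The part of the tree hanging below `S` keeps its place.
The set `E` of the vertices outside `f '' K` not adjacent to `f '' S` satisfies Hall's condition, by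
the choice of `S` even with one vertex to spare, so it can receive a new image of a lowest vertex
`q` of `K` whose parent is not in `S` and, outside the branch at `q`, all children of `K \ S` not
in `K`.  The branch at `q` is then embedded afresh, and the vertex of `X` used by the old branch
becomes free.  The branch has sufficiently many childless vertices for all others to fit into `E`
(`Rooting.card_exits_le_card_leaves`); the childless ones can be placed anywhere in `H` but on that
vertex of `X`. -/
lemma IsTree.exists_fitsIn_erase (hT : T.IsTree) {H X : Finset V} (hX : X.Nonempty)
    (hdeg : ∀ v ∈ H, v ∉ X → Fintype.card W ≤ G.degIn H v) {f : W → V}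
    (hinj : Function.Injective f) (hhom : ∀ a b, T.Adj a b → G.Adj (f a) (f b))
    (hfH : ∀ w, f w ∈ H) (hfree : ∃ c ∈ H, ∀ w, f w ≠ c) :
    ∃ x ∈ X, T.FitsIn G (H.erase x) := by
  by_cases hXf : ∃ x ∈ X, ∀ w, f w ≠ x
  · obtain ⟨x, hx, hxf⟩ := hXf
    exact ⟨x, hx, f, hinj, hhom, fun w => Finset.mem_erase.mpr ⟨hxf w, hfH w⟩⟩
  push Not at hXf
  obtain ⟨x0, hx0⟩ := hX
  obtain ⟨r, hr⟩ := hXf x0 hx0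
  obtain ⟨R, hRr⟩ := hT.exists_rooting r
  have hfroot : f R.root ∈ X := by rw [hRr, hr]; exact hx0
  have : Nonempty V := ⟨x0⟩
  -- the subtree spanned by the root and the preimage of `X`
  set K : Finset W := Finset.univ.filter (fun w => ∃ v, R.Anc w v ∧ f v ∈ X) with hK
  have hKmem : ∀ w, w ∈ K ↔ ∃ v, R.Anc w v ∧ f v ∈ X := by simp [hK]
  have hKpar : ∀ w ∈ K, R.par w ∈ K := by
    intro w hw
    obtain ⟨v, h1, h2⟩ := (hKmem w).mp hw
    exact (hKmem _).mpr ⟨v, (Rooting.anc_par w).trans h1, h2⟩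
  have hKroot : R.root ∈ K := (hKmem _).mpr ⟨_, Rooting.Anc.refl _, hfroot⟩
  set D := H \ K.image f with hD
  have hDX : ∀ d ∈ D, d ∉ X := by
    intro d hd hdX
    obtain ⟨w, rfl⟩ := hXf d hdX
    rw [hD, Finset.mem_sdiff] at hd
    exact hd.2 (Finset.mem_image_of_mem f ((hKmem w).mpr ⟨w, Rooting.Anc.refl _, hdX⟩))
  have hDH : D ⊆ H := Finset.sdiff_subset
  have hfD : ∀ w, w ∉ K → f w ∈ D := by
    intro w hw
    refine Finset.mem_sdiff.mpr ⟨hfH w, fun h => ?_⟩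
    obtain ⟨v, hv, hvw⟩ := Finset.mem_image.mp h
    exact hw (hinj hvw ▸ hv)
  have hfnD : ∀ w ∈ K, f w ∉ D := fun w hw h =>
    (Finset.mem_sdiff.mp h).2 (Finset.mem_image_of_mem f hw)
  set N : Finset W → Finset V := fun S => D.filter (fun d => ∃ w ∈ S, G.Adj (f w) d) with hN
  have hNmem : ∀ S d, d ∈ N S ↔ d ∈ D ∧ ∃ w ∈ S, G.Adj (f w) d := by simp [hN]
  set rts : Finset W → Finset W := fun S => Finset.univ.filter (fun s => s ∉ K ∧ R.par s ∈ S)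
    with hrts
  have hrmem : ∀ S s, s ∈ rts S ↔ s ∉ K ∧ R.par s ∈ S := by simp [hrts]
  -- a largest set `S ⊆ K` whose neighbours outside `f '' K` are all needed for its children
  obtain ⟨S, hS, hSmax⟩ := Finset.exists_max_image
    (K.powerset.filter (fun S => (N S).card ≤ (rts S).card)) Finset.card
    ⟨∅, by simp [hN]⟩
  simp only [Finset.mem_filter, Finset.mem_powerset, and_imp] at hS hSmax
  obtain ⟨hSK, hStight⟩ := hS
  have hhall : ∀ S' ⊆ K \ S, S'.Nonempty → (rts S').card + 1 ≤ (N S' \ N S).card := by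
    intro S' hS' hne
    by_contra hcon
    have hdisj : Disjoint S S' :=
      Finset.disjoint_left.mpr fun a ha ha' => (Finset.mem_sdiff.mp (hS' ha')).2 ha
    have h1 : N (S ∪ S') = N S ∪ (N S' \ N S) := by
      ext d
      simp only [Finset.mem_union, Finset.mem_sdiff, hNmem]
      constructor
      · rintro ⟨hd, w, hw | hw, hadj⟩
        · exact Or.inl ⟨hd, w, hw, hadj⟩
        · by_cases h : ∃ w ∈ S, G.Adj (f w) d
          · exact Or.inl ⟨hd, h⟩
          · exact Or.inr ⟨⟨hd, w, hw, hadj⟩, fun h' => h h'.2⟩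
      · rintro (⟨hd, w, hw, hadj⟩ | ⟨⟨hd, w, hw, hadj⟩, -⟩)
        · exact ⟨hd, w, Or.inl hw, hadj⟩
        · exact ⟨hd, w, Or.inr hw, hadj⟩
    have h2 : rts (S ∪ S') = rts S ∪ rts S' := by
      ext s
      simp only [Finset.mem_union, hrmem]
      tauto
    have h3 : Disjoint (rts S) (rts S') := by
      refine Finset.disjoint_left.mpr fun s hs hs' => ?_
      rw [hrmem] at hs hs'
      exact Finset.disjoint_left.mp hdisj hs.2 hs'.2
    have h4 := hSmax (S ∪ S')
      (Finset.union_subset hSK (hS'.trans Finset.sdiff_subset)) (by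
        rw [h1, h2, Finset.card_union_of_disjoint h3]
        have := Finset.card_union_le (N S) (N S' \ N S)
        omega)
    rw [Finset.card_union_of_disjoint hdisj] at h4
    have := Finset.card_pos.mpr hne
    omega
  -- a deepest vertex of `K` whose parent is outside `S`
  obtain ⟨q, hq, hqmax⟩ := Finset.exists_max_image
    (K.filter (fun q => q = R.root ∨ R.par q ∉ S)) R.dep ⟨R.root, by simp [hKroot]⟩
  simp only [Finset.mem_filter, and_imp] at hq hqmax
  obtain ⟨hqK, hqS⟩ := hq
  have hbelow : ∀ v ∈ K, R.Anc q v → v ≠ q → R.par v ∈ S := by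
    intro v hv hqv hne
    by_contra h
    exact absurd (hqmax v hv (Or.inr h)) (not_le.mpr (hqv.dep_lt hne))
  obtain ⟨v0, hqv0, hv0X⟩ := (hKmem q).mp hqK
  have hv0K : v0 ∈ K := (hKmem _).mpr ⟨v0, Rooting.Anc.refl _, hv0X⟩
  refine ⟨f v0, hv0X, ?_⟩
  set E := D \ N S with hE
  have hEmem : ∀ d, d ∈ E ↔ d ∈ D ∧ ∀ w ∈ S, ¬ G.Adj (f w) d := by
    intro d
    rw [hE, Finset.mem_sdiff, hNmem]
    push Not
    exact ⟨fun h => ⟨h.1, h.2 h.1⟩, fun h => ⟨h.1, fun _ => h.2⟩⟩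
  have hEne : E.Nonempty := by
    obtain ⟨c, hcH, hcf⟩ := hfree
    rw [← Finset.card_pos, hE]
    have h1 := Finset.le_card_sdiff (N S) D
    have h2 : (insert c (Kᶜ.image f)) ⊆ D := by
      intro d hd
      rcases Finset.mem_insert.mp hd with rfl | hd
      · refine Finset.mem_sdiff.mpr ⟨hcH, fun h => ?_⟩
        obtain ⟨v, -, hv⟩ := Finset.mem_image.mp h
        exact hcf v hv
      · obtain ⟨w, hw, rfl⟩ := Finset.mem_image.mp hd
        exact hfD w (Finset.mem_compl.mp hw)
    have h3 := Finset.card_le_card h2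
    rw [Finset.card_insert_of_notMem, Finset.card_image_of_injective _ hinj] at h3
    · have h4 : rts S ⊆ Kᶜ := by
        intro s hs
        rw [hrmem] at hs
        simpa using hs.1
      have := Finset.card_le_card h4
      omega
    · intro h
      obtain ⟨v, -, hv⟩ := Finset.mem_image.mp h
      exact hcf v hv
  have hEdeg : ∀ y ∈ E, Fintype.card W ≤ G.degIn E y + (N S).card + (K \ S).card := by
    intro y hy
    have hy' := (hEmem y).mp hy
    refine (hdeg y (hDH hy'.1) (hDX y hy'.1)).trans ?_
    have hsub : H.filter (G.Adj y) ⊆ E.filter (G.Adj y) ∪ N S ∪ (K \ S).image f := by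
      intro z hz
      rw [Finset.mem_filter] at hz
      simp only [Finset.mem_union, Finset.mem_filter, Finset.mem_image, Finset.mem_sdiff]
      by_cases hzD : z ∈ D
      · by_cases hzN : z ∈ N S
        · exact Or.inl (Or.inr hzN)
        · exact Or.inl (Or.inl ⟨Finset.mem_sdiff.mpr ⟨hzD, hzN⟩, hz.2⟩)
      · have : z ∈ K.image f := by
          by_contra h
          exact hzD (Finset.mem_sdiff.mpr ⟨hz.1, h⟩)
        obtain ⟨w, hw, rfl⟩ := Finset.mem_image.mp this
        exact Or.inr ⟨w, ⟨hw, fun h => hy'.2 w h hz.2.symm⟩, rfl⟩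
    refine (Finset.card_le_card hsub).trans ?_
    refine (Finset.card_union_le _ _).trans ?_
    refine add_le_add (Finset.card_union_le _ _) Finset.card_image_le
  have hNdeg : ∀ y ∈ N S, Fintype.card W + 1 ≤ G.degIn E y + (N S).card + K.card := by
    intro y hy
    have hy' := ((hNmem S y).mp hy).1
    have h0 := hdeg y (hDH hy') (hDX y hy')
    have hsub : H.filter (G.Adj y) ⊆ E.filter (G.Adj y) ∪ (N S).erase y ∪ K.image f := by
      intro z hz
      rw [Finset.mem_filter] at hz
      simp only [Finset.mem_union, Finset.mem_filter, Finset.mem_erase]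
      by_cases hzD : z ∈ D
      · by_cases hzN : z ∈ N S
        · exact Or.inl (Or.inr ⟨fun h => G.loopless.irrefl y (h ▸ hz.2), hzN⟩)
        · exact Or.inl (Or.inl ⟨Finset.mem_sdiff.mpr ⟨hzD, hzN⟩, hz.2⟩)
      · right
        by_contra h
        exact hzD (Finset.mem_sdiff.mpr ⟨hz.1, h⟩)
    have h1 := Finset.card_le_card hsub
    have h2 := Finset.card_union_le (E.filter (G.Adj y) ∪ (N S).erase y) (K.image f)
    have h3 := Finset.card_union_le (E.filter (G.Adj y)) ((N S).erase y)
    have h4 : (K.image f).card ≤ K.card := Finset.card_image_le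
    have h5 := Finset.card_erase_of_mem hy
    have h6 : 0 < (N S).card := Finset.card_pos.mpr ⟨y, hy⟩
    unfold degIn at *
    omega
  -- the parts of the tree, in the order in which they are embedded
  set Ko := Finset.univ.filter (fun w => ¬ R.Anc q w ∧ w ∈ K) with hKo
  set So := Finset.univ.filter (fun w => ¬ R.Anc q w ∧ w ∉ K ∧ R.par w ∈ S) with hSo
  set Io := Finset.univ.filter (fun w => ¬ R.Anc q w ∧ w ∉ K ∧ R.par w ∉ S ∧ R.par w ∈ K) with hIo
  set Lo := Finset.univ.filter (fun w => ¬ R.Anc q w ∧ w ∉ K ∧ R.par w ∉ K) with hLo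
  set Li := Finset.univ.filter (fun w => R.Anc q w ∧ w ≠ q ∧ ∃ u, u ≠ R.root ∧ R.par u = w) with hLi
  set Lf := Finset.univ.filter
    (fun w => R.Anc q w ∧ w ≠ q ∧ ∀ u, u ≠ R.root → R.par u ≠ w) with hLf
  obtain ⟨c1, c2, c3⟩ := Rooting.card_parts q K S hSK hbelow hKo hSo hIo hLo hLi hLf
  have c4 := hStight
  simp only [hrts] at c4
  have hqpar : q ≠ R.root → ¬ R.Anc q (R.par q) ∧ R.par q ∈ K ∧ R.par q ∉ S := by
    intro h
    refine ⟨fun h' => ?_, hKpar q hqK, hqS.resolve_left h⟩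
    have h1 := R.dep_par q h
    by_cases h2 : R.par q = q
    · rw [h2] at h1
      exact lt_irrefl _ h1
    · exact absurd (h'.dep_lt h2) (not_lt.mpr h1.le)
  have hqIo : q ∉ Io := by simp [hIo, Rooting.Anc.refl]
  -- Hall's theorem places `q` and the children of `K \ S` outside the branch
  -- Hall's condition for the roots of the branches which move into `E`, including `q`
  obtain ⟨h, hhinj, hht⟩ := exists_injOn_of_hall (insert q Io)
    (fun s => if s = R.root then E else E.filter (G.Adj (f (R.par s)))) (by
      intro A hA
      by_cases hrA : R.root ∈ A
      · have hqr : q = R.root := by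
          rcases Finset.mem_insert.mp (hA hrA) with h | h
          · exact h.symm
          · simp only [hIo, Finset.mem_filter] at h
            exact absurd hKroot h.2.2.1
        have h1 : A ⊆ {R.root} := by
          intro s hs
          rcases Finset.mem_insert.mp (hA hs) with h | h
          · rw [Finset.mem_singleton, h, hqr]
          · simp only [hIo, Finset.mem_filter, hqr] at h
            exact absurd (Rooting.anc_root s) h.2.1
        have h2 := Finset.card_le_card h1
        have h3 : E ⊆ A.biUnion
            (fun s => if s = R.root then E else E.filter (G.Adj (f (R.par s)))) := by
          intro d hd
          exact Finset.mem_biUnion.mpr ⟨_, hrA, by simpa using hd⟩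
        have h4 := Finset.card_le_card h3
        have h5 := Finset.card_pos.mpr hEne
        simp only [Finset.card_singleton] at h2
        omega
      · rcases A.eq_empty_or_nonempty with rfl | hne
        · simp
        have hAr : ∀ s ∈ A, s ≠ R.root := fun s hs h => hrA (h ▸ hs)
        have hsub : A.image R.par ⊆ K \ S := by
          intro w hw
          obtain ⟨s, hs, rfl⟩ := Finset.mem_image.mp hw
          rw [Finset.mem_sdiff]
          rcases Finset.mem_insert.mp (hA hs) with h | h
          · subst h
            exact (hqpar (hAr _ hs)).2
          · simp only [hIo, Finset.mem_filter] at h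
            exact ⟨h.2.2.2.2, h.2.2.2.1⟩
        have h1 := hhall _ hsub (hne.image _)
        have h2 : A.erase q ⊆ rts (A.image R.par) := by
          intro s hs
          obtain ⟨hsq, hs⟩ := Finset.mem_erase.mp hs
          rcases Finset.mem_insert.mp (hA hs) with h | h
          · exact absurd h hsq
          · simp only [hIo, Finset.mem_filter] at h
            exact (hrmem _ _).mpr ⟨h.2.2.1, Finset.mem_image_of_mem _ hs⟩
        have h3 : N (A.image R.par) \ N S ⊆ A.biUnion
            (fun s => if s = R.root then E else E.filter (G.Adj (f (R.par s)))) := by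
          intro d hd
          obtain ⟨hd1, hd2⟩ := Finset.mem_sdiff.mp hd
          obtain ⟨hdD, w, hw, hadj⟩ := (hNmem _ _).mp hd1
          obtain ⟨s, hs, rfl⟩ := Finset.mem_image.mp hw
          refine Finset.mem_biUnion.mpr ⟨s, hs, ?_⟩
          rw [if_neg (hAr s hs), Finset.mem_filter]
          exact ⟨Finset.mem_sdiff.mpr ⟨hdD, hd2⟩, hadj⟩
        have h4 := Finset.card_le_card h2
        have h5 := Finset.card_le_card h3
        have h6 := Finset.pred_card_le_card_erase (s := A) (a := q)
        omega)
  have hhE : ∀ s ∈ insert q Io, h s ∈ E := by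
    intro s hs
    have := hht s hs
    split_ifs at this
    · exact this
    · exact (Finset.mem_filter.mp this).1
  have hhadj : ∀ s ∈ insert q Io, s ≠ R.root → G.Adj (f (R.par s)) (h s) := by
    intro s hs hsr
    have := hht s hs
    rw [if_neg hsr] at this
    exact (Finset.mem_filter.mp this).2
  set A0 := Ko ∪ So ∪ insert q Io with hA0
  set g0 : W → V := fun w => if w ∈ insert q Io then h w else f w with hg0
  have hg0I : ∀ w ∈ insert q Io, g0 w = h w := fun w hw => if_pos hw
  have hKoI : ∀ w ∈ Ko ∪ So, w ∉ insert q Io := by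
    intro w hw hw'
    rcases Finset.mem_insert.mp hw' with rfl | hw'
    · simp [hKo, hSo, Rooting.Anc.refl] at hw
    · simp only [hKo, hSo, hIo, Finset.mem_union, Finset.mem_filter, Finset.mem_univ,
        true_and] at hw hw'
      tauto
  have hg0K : ∀ w ∈ Ko ∪ So, g0 w = f w := fun w hw => if_neg (hKoI w hw)
  have hSoN : ∀ w ∈ So, f w ∈ N S := by
    intro w hw
    simp only [hSo, Finset.mem_filter, Finset.mem_univ, true_and] at hw
    refine (hNmem _ _).mpr ⟨hfD w hw.2.1, _, hw.2.2, hhom _ _ (R.adj_par w ?_)⟩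
    rintro rfl
    exact hw.2.1 hKroot
  have hKSE : ∀ w ∈ Ko ∪ So, f w ∉ E := by
    intro w hw hwE
    rw [hE, Finset.mem_sdiff] at hwE
    rcases Finset.mem_union.mp hw with hw | hw
    · simp only [hKo, Finset.mem_filter] at hw
      exact hfnD w hw.2.2 hwE.1
    · exact hwE.2 (hSoN w hw)
  have hg0inj : Set.InjOn g0 A0 := by
    intro a ha b hb hab
    simp only [hA0, Finset.mem_coe] at ha hb
    rcases Finset.mem_union.mp ha with ha | ha <;> rcases Finset.mem_union.mp hb with hb | hb
    · rw [hg0K a ha, hg0K b hb] at hab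
      exact hinj hab
    · rw [hg0K a ha, hg0I b hb] at hab
      exact absurd (hab ▸ hhE b hb) (hKSE a ha)
    · rw [hg0I a ha, hg0K b hb] at hab
      exact absurd (hab ▸ hhE a ha) (hKSE b hb)
    · rw [hg0I a ha, hg0I b hb] at hab
      exact hhinj ha hb hab
  have hU0 : (A0.filter (fun a => g0 a ∈ E)).card ≤ Io.card + 1 := by
    refine (Finset.card_le_card (t := insert q Io) ?_).trans (Finset.card_insert_le _ _)
    intro w hw
    rw [Finset.mem_filter] at hw
    rcases Finset.mem_union.mp hw.1 with h | h
    · rw [hg0K w h] at hw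
      exact absurd hw.2 (hKSE w h)
    · exact h
  have hA0nanc : ∀ w ∈ A0, w ≠ q → ¬ R.Anc q w := by
    intro w hw hne
    simp only [hA0, hKo, hSo, hIo, Finset.mem_union, Finset.mem_insert, Finset.mem_filter,
      Finset.mem_univ, true_and] at hw
    tauto
  have hqA0 : q ∈ A0 := by simp [hA0]
  have hcover : ∀ w, ¬ R.Anc q w → w ∈ A0 ∪ Lo := by
    intro w hw
    simp only [hA0, hKo, hSo, hIo, hLo, Finset.mem_union, Finset.mem_insert, Finset.mem_filter,
      Finset.mem_univ, true_and]
    tauto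
  have hLomem : ∀ w ∈ Lo, ¬ R.Anc q w ∧ w ∉ K ∧ R.par w ∉ K := by
    intro w hw
    simpa [hLo] using hw
  have hLimem : ∀ w ∈ Li, R.Anc q w ∧ w ≠ q ∧ ∃ u, u ≠ R.root ∧ R.par u = w := by
    intro w hw
    simpa only [hLi, Finset.mem_filter, Finset.mem_univ, true_and] using hw
  have hLfmem : ∀ w ∈ Lf, R.Anc q w ∧ w ≠ q ∧ ∀ u, u ≠ R.root → R.par u ≠ w := by
    intro w hw
    simpa only [hLf, Finset.mem_filter, Finset.mem_univ, true_and] using hw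
  have hAncroot : ∀ w, R.Anc q w → w ≠ q → w ≠ R.root := by
    intro w hw hne hr
    rw [hr] at hw hne
    obtain ⟨n, hn⟩ := hw
    rw [Rooting.par_iterate_root] at hn
    exact hne hn
  -- the rest of the tree outside the branch at `q`
  obtain ⟨g1, h1A, h1inj, h1L⟩ := R.extend (G := G) E _ g0 A0 Lo rfl
    (Finset.disjoint_left.mpr fun w hw hw' => by
      have h1 := hLomem w hw'
      simp only [hA0, hKo, hSo, hIo, Finset.mem_union, Finset.mem_insert, Finset.mem_filter,
        Finset.mem_univ, true_and] at hw
      have h2 := @hSK (R.par w)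
      have h3 : w ≠ q := fun h => h1.1 (h ▸ Rooting.Anc.refl _)
      tauto)
    (fun h => (hLomem _ h).2.1 hKroot)
    (fun v hv => hcover _ fun h => (hLomem v hv).1 h.of_par)
    hg0inj
    (by
      intro v hv hpv
      have hv' := hLomem v hv
      rcases Finset.mem_union.mp hpv with hp | hp
      · have hpS : R.par v ∈ So := by
          rcases Finset.mem_union.mp hp with hp' | hp'
          · simp only [hKo, Finset.mem_filter] at hp'
            exact absurd hp'.2.2 hv'.2.2
          · exact hp'
        rw [hg0K _ hp, if_neg (hKSE _ hp)]
        have := hNdeg _ (hSoN _ hpS)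
        omega
      · rw [hg0I _ hp, if_pos (hhE _ hp)]
        have := hEdeg _ (hhE _ hp)
        omega)
    (by
      intro v _ _ y hy
      have := hEdeg y hy
      omega)
  have hU1 : ((A0 ∪ Lo).filter (fun a => g1 a ∈ E)).card ≤ Io.card + 1 + Lo.card := by
    rw [Finset.filter_union]
    refine (Finset.card_union_le _ _).trans (add_le_add ?_ (Finset.card_filter_le _ _))
    refine le_trans (le_of_eq ?_) hU0
    congr 1
    exact Finset.filter_congr fun a ha => by rw [h1A a ha]
  -- the vertices of the branch at `q` which have children
  obtain ⟨g2, h2A, h2inj, h2L⟩ := R.extend (G := G) E _ g1 (A0 ∪ Lo) Li rfl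
    (Finset.disjoint_left.mpr fun w hw hw' => by
      have h1 := hLimem w hw'
      rcases Finset.mem_union.mp hw with h | h
      · exact hA0nanc w h h1.2.1 h1.1
      · exact (hLomem w h).1 h1.1)
    (fun h => hAncroot _ (hLimem _ h).1 (hLimem _ h).2.1 rfl)
    (by
      intro v hv
      obtain ⟨h1, h2, -⟩ := hLimem v hv
      by_cases h3 : R.par v = q
      · rw [h3]
        exact Finset.mem_union_left _ (Finset.mem_union_left _ hqA0)
      · refine Finset.mem_union_right _ ?_
        simp only [hLi, Finset.mem_filter, Finset.mem_univ, true_and]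
        exact ⟨h1.par_of_ne h2, h3, v, hAncroot v h1 h2, rfl⟩)
    h1inj
    (by
      intro v hv hpv
      obtain ⟨h1, h2, -⟩ := hLimem v hv
      have h3 : R.par v = q := by
        by_contra h3
        rcases Finset.mem_union.mp hpv with h | h
        · exact hA0nanc _ h h3 (h1.par_of_ne h2)
        · exact (hLomem _ h).1 (h1.par_of_ne h2)
      have h4 : g1 (R.par v) ∈ E := by
        rw [h3, h1A q hqA0, hg0I q (Finset.mem_insert_self _ _)]
        exact hhE q (Finset.mem_insert_self _ _)
      rw [if_pos h4]
      have := hEdeg _ h4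
      omega)
    (by
      intro v _ _ y hy
      have := hEdeg y hy
      omega)
  have hqE : g2 q ∈ E := by
    rw [h2A q (Finset.mem_union_left _ hqA0), h1A q hqA0, hg0I q (Finset.mem_insert_self _ _)]
    exact hhE q (Finset.mem_insert_self _ _)
  have hfvE : ∀ y ∈ E, y ∈ H.erase (f v0) := by
    intro y hy
    have hyD := ((hEmem y).mp hy).1
    exact Finset.mem_erase.mpr ⟨fun h => hfnD v0 hv0K (h ▸ hyD), hDH hyD⟩
  -- the childless vertices of the branch at `q`
  obtain ⟨g, hgA, hginj, hgL⟩ := R.extend (G := G) (H.erase (f v0)) _ g2 (A0 ∪ Lo ∪ Li) Lf rfl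
    (Finset.disjoint_left.mpr fun w hw hw' => by
      have h1 := hLfmem w hw'
      rcases Finset.mem_union.mp hw with h | h
      · rcases Finset.mem_union.mp h with h | h
        · exact hA0nanc w h h1.2.1 h1.1
        · exact (hLomem w h).1 h1.1
      · obtain ⟨-, -, u, hu, huw⟩ := hLimem w h
        exact h1.2.2 u hu huw)
    (fun h => hAncroot _ (hLfmem _ h).1 (hLfmem _ h).2.1 rfl)
    (by
      intro v hv
      obtain ⟨h1, h2, -⟩ := hLfmem v hv
      refine Finset.mem_union_left _ ?_
      by_cases h3 : R.par v = q
      · rw [h3]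
        exact Finset.mem_union_left _ (Finset.mem_union_left _ hqA0)
      · refine Finset.mem_union_right _ ?_
        simp only [hLi, Finset.mem_filter, Finset.mem_univ, true_and]
        exact ⟨h1.par_of_ne h2, h3, v, hAncroot v h1 h2, rfl⟩)
    h2inj
    (by
      intro v hv _
      obtain ⟨h1, h2, -⟩ := hLfmem v hv
      have h4 : g2 (R.par v) ∈ E := by
        by_cases h3 : R.par v = q
        · rw [h3]
          exact hqE
        · refine (h2L _ ?_).1
          simp only [hLi, Finset.mem_filter, Finset.mem_univ, true_and]
          exact ⟨h1.par_of_ne h2, h3, v, hAncroot v h1 h2, rfl⟩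
      rw [if_pos (hfvE _ h4)]
      have h5 := ((hEmem _).mp h4).1
      have h6 := hdeg _ (hDH h5) (hDX _ h5)
      have h7 : G.degIn H (g2 (R.par v)) ≤ G.degIn (H.erase (f v0)) (g2 (R.par v)) + 1 := by
        unfold degIn
        rw [Finset.filter_erase]
        have := Finset.pred_card_le_card_erase (s := H.filter (G.Adj (g2 (R.par v)))) (a := f v0)
        omega
      have h8 := Finset.card_filter_le (A0 ∪ Lo ∪ Li) (fun a => g2 a ∈ H.erase (f v0))
      have h9 := Finset.card_union_le (A0 ∪ Lo) Li
      have h10 := Finset.card_union_le A0 Lo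
      have h11 := Finset.card_union_le (Ko ∪ So) (insert q Io)
      have h12 := Finset.card_union_le Ko So
      rw [← hA0] at h11
      have h13 := Finset.card_insert_le q Io
      omega)
    (by
      intro v hv hpv
      exact absurd rfl ((hLfmem _ hpv).2.2 v
        (hAncroot v (hLfmem v hv).1 (hLfmem v hv).2.1)))
  have hall : ∀ w, w ∈ A0 ∪ Lo ∪ Li ∪ Lf := by
    intro w
    by_cases hw : R.Anc q w
    · by_cases hwq : w = q
      · subst hwq
        simp [hqA0]
      · simp only [hLi, hLf, Finset.mem_union, Finset.mem_filter, Finset.mem_univ, true_and]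
        by_cases h : ∃ u, u ≠ R.root ∧ R.par u = w
        · exact Or.inl (Or.inr ⟨hw, hwq, h⟩)
        · push Not at h
          exact Or.inr ⟨hw, hwq, h⟩
    · exact Finset.mem_union_left _ (Finset.mem_union_left _ (hcover w hw))
  have hg0g : ∀ w ∈ A0, g w = g0 w := by
    intro w hw
    rw [hgA w (by simp [hw]), h2A w (by simp [hw]), h1A w hw]
  have hg1g : ∀ w ∈ A0 ∪ Lo, g w = g1 w := by
    intro w hw
    rw [hgA w (Finset.mem_union_left _ hw), h2A w hw]
  have hpar2 : ∀ w ∈ Li, g (R.par w) = g2 (R.par w) := by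
    intro v hv
    obtain ⟨h1, h2, -⟩ := hLimem v hv
    refine hgA _ ?_
    by_cases h3 : R.par v = q
    · rw [h3]
      simp [hqA0]
    · refine Finset.mem_union_right _ ?_
      simp only [hLi, Finset.mem_filter, Finset.mem_univ, true_and]
      exact ⟨h1.par_of_ne h2, h3, v, hAncroot v h1 h2, rfl⟩
  have hKopar : ∀ w, ¬ R.Anc q w → R.par w ∈ K → g (R.par w) = f (R.par w) := by
    intro w hw hwK
    have h1 : R.par w ∈ Ko ∪ So := by
      simp only [hKo, Finset.mem_union, Finset.mem_filter, Finset.mem_univ, true_and]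
      exact Or.inl ⟨fun h => hw h.of_par, hwK⟩
    rw [hg0g _ (Finset.mem_union_left _ h1), hg0K _ h1]
  refine ⟨g, fun a b hab => hginj (hall a) (hall b) hab, R.hom_of_adj_par ?_, ?_⟩
  · intro w hwr
    rcases Finset.mem_union.mp (hall w) with hw | hw
    · rcases Finset.mem_union.mp hw with hw | hw
      · rcases Finset.mem_union.mp hw with hw | hw
        · rcases Finset.mem_union.mp hw with hw' | hw'
          · rw [hg0g w hw, hg0K w hw', hKopar w]
            · exact hhom _ _ (R.adj_par w hwr)
            · simp only [hKo, hSo, Finset.mem_union, Finset.mem_filter, Finset.mem_univ,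
                true_and] at hw'
              tauto
            · simp only [hKo, hSo, Finset.mem_union, Finset.mem_filter, Finset.mem_univ,
                true_and] at hw'
              rcases hw' with h | h
              · exact hKpar w h.2
              · exact hSK h.2.2
          · rw [hg0g w hw, hg0I w hw']
            have h1 := hhadj w hw' hwr
            rcases Finset.mem_insert.mp hw' with h | h
            · subst h
              have h2 := hqpar hwr
              have h3 : R.par w ∈ Ko ∪ So := by
                simp only [hKo, Finset.mem_union, Finset.mem_filter, Finset.mem_univ, true_and]
                exact Or.inl ⟨h2.1, h2.2.1⟩
              rw [hg0g _ (Finset.mem_union_left _ h3), hg0K _ h3]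
              exact h1
            · simp only [hIo, Finset.mem_filter, Finset.mem_univ, true_and] at h
              rw [hKopar w h.1 h.2.2.2]
              exact h1
        · rw [hg1g w (Finset.mem_union_right _ hw),
            hg1g _ (hcover _ fun h => (hLomem w hw).1 h.of_par)]
          exact (h1L w hw).2
      · rw [hpar2 w hw, hgA w (Finset.mem_union_right _ hw)]
        exact (h2L w hw).2
    · exact (hgL w hw).2
  · intro w
    rcases Finset.mem_union.mp (hall w) with hw | hw
    · rcases Finset.mem_union.mp hw with hw | hw
      · rcases Finset.mem_union.mp hw with hw | hw
        · rcases Finset.mem_union.mp hw with hw' | hw'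
          · rw [hg0g w hw, hg0K w hw', Finset.mem_erase]
            refine ⟨fun h => ?_, hfH w⟩
            have := hinj h
            subst this
            simp only [hKo, hSo, Finset.mem_union, Finset.mem_filter, Finset.mem_univ,
              true_and] at hw'
            tauto
          · rw [hg0g w hw, hg0I w hw']
            exact hfvE _ (hhE w hw')
        · rw [hg1g w (Finset.mem_union_right _ hw)]
          exact hfvE _ (h1L w hw).1
      · rw [hgA w (Finset.mem_union_right _ hw)]
        exact hfvE _ (h2L w hw).1
    · exact (hgL w hw).1

end Avoiding

end SimpleGraph

/-! ### Cuts, tight sets and admissible sets -/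

namespace SimpleGraph

section Cuts

open scoped Classical

variable {V : Type*} {G : SimpleGraph V}

/-- The number of edges between `S` and `Y`, for disjoint sets `S` and `Y`. -/
noncomputable def crossing (G : SimpleGraph V) (S Y : Finset V) : ℕ := ∑ v ∈ S, G.degIn Y v

/-- The number of edges of `G[B]` leaving the set `S ⊆ B`. -/
noncomputable def cut (G : SimpleGraph V) (B S : Finset V) : ℕ := G.crossing S (B \ S)

lemma degIn_empty (v : V) : G.degIn ∅ v = 0 := by simp [degIn]

lemma degIn_singleton (v w : V) : G.degIn {w} v = if G.Adj v w then 1 else 0 := by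
  unfold degIn
  split_ifs with h <;> simp [Finset.filter_singleton, h]

lemma degIn_pos_iff {Y : Finset V} {v : V} : 0 < G.degIn Y v ↔ ∃ y ∈ Y, G.Adj v y := by
  unfold degIn
  rw [Finset.card_pos]
  exact ⟨fun ⟨y, hy⟩ => ⟨y, Finset.mem_filter.mp hy⟩, fun ⟨y, hy⟩ => ⟨y, Finset.mem_filter.mpr hy⟩⟩

lemma degIn_eq_zero_iff {Y : Finset V} {v : V} : G.degIn Y v = 0 ↔ ∀ y ∈ Y, ¬ G.Adj v y := by
  rw [← Nat.le_zero, ← not_lt, degIn_pos_iff]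
  push Not
  rfl

lemma degIn_sdiff_add {Y Z : Finset V} (h : Z ⊆ Y) (v : V) :
    G.degIn (Y \ Z) v + G.degIn Z v = G.degIn Y v := by
  rw [← degIn_union Finset.sdiff_disjoint, Finset.sdiff_union_of_subset h]

@[simp] lemma crossing_empty_left (Y : Finset V) : G.crossing ∅ Y = 0 := by simp [crossing]

@[simp] lemma crossing_empty_right (S : Finset V) : G.crossing S ∅ = 0 := by
  simp [crossing, degIn_empty]

lemma crossing_singleton_left (v : V) (Y : Finset V) : G.crossing {v} Y = G.degIn Y v := by
  simp [crossing]

lemma crossing_union_left {S S' : Finset V} (h : Disjoint S S') (Y : Finset V) :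
    G.crossing (S ∪ S') Y = G.crossing S Y + G.crossing S' Y :=
  Finset.sum_union h

lemma crossing_union_right (S : Finset V) {Y Y' : Finset V} (h : Disjoint Y Y') :
    G.crossing S (Y ∪ Y') = G.crossing S Y + G.crossing S Y' := by
  unfold crossing
  rw [← Finset.sum_add_distrib]
  exact Finset.sum_congr rfl fun v _ => degIn_union h v

lemma crossing_comm (S Y : Finset V) : G.crossing S Y = G.crossing Y S := by
  unfold crossing degIn
  simp only [Finset.card_filter]
  rw [Finset.sum_comm]
  simp only [G.adj_comm]

lemma crossing_pos_iff {S Y : Finset V} :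
    0 < G.crossing S Y ↔ ∃ v ∈ S, ∃ y ∈ Y, G.Adj v y := by
  unfold crossing
  rw [Finset.sum_pos_iff]
  simp only [degIn_pos_iff]

lemma degIn_le_crossing {S : Finset V} (Y : Finset V) {v : V} (hv : v ∈ S) :
    G.degIn Y v ≤ G.crossing S Y :=
  Finset.single_le_sum (f := fun v => G.degIn Y v) (fun _ _ => Nat.zero_le _) hv

/-- A cut of `G[B ∪ Q]`, split according to the parts `B` and `Q`. -/
lemma cut_union {B Q S R : Finset V} (hBQ : Disjoint B Q) (hS : S ⊆ B) (hR : R ⊆ Q) :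
    G.cut (B ∪ Q) (S ∪ R) =
      G.cut B S + G.crossing S (Q \ R) + G.crossing R (B \ S) + G.crossing R (Q \ R) := by
  have hSR : Disjoint S R := hBQ.mono hS hR
  have h1 : (B ∪ Q) \ (S ∪ R) = (B \ S) ∪ (Q \ R) := by
    ext v
    simp only [Finset.mem_sdiff, Finset.mem_union]
    have h2 : v ∈ B → v ∉ Q := fun h h' => Finset.disjoint_left.mp hBQ h h'
    have h3 := @hS v
    have h4 := @hR v
    tauto
  unfold cut
  rw [h1, crossing_union_left hSR,
    crossing_union_right _ (hBQ.mono Finset.sdiff_subset Finset.sdiff_subset),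
    crossing_union_right _ (hBQ.mono Finset.sdiff_subset Finset.sdiff_subset)]
  omega

/-- Cuts are submodular. -/
lemma cut_union_add_cut_inter_le {B S T : Finset V} (hS : S ⊆ B) (hT : T ⊆ B) :
    G.cut B (S ∪ T) + G.cut B (S ∩ T) ≤ G.cut B S + G.cut B T := by
  set a := S ∩ T
  set b := S \ T
  set c := T \ S
  set d := B \ (S ∪ T)
  have hab : Disjoint a b := by
    rw [Finset.disjoint_left]; simp only [a, b, Finset.mem_inter, Finset.mem_sdiff]; tauto
  have hac : Disjoint a c := by
    rw [Finset.disjoint_left]; simp only [a, c, Finset.mem_inter, Finset.mem_sdiff]; tauto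
  have hbc : Disjoint b c := by
    rw [Finset.disjoint_left]; simp only [b, c, Finset.mem_sdiff]; tauto
  have hbd : Disjoint b d := by
    rw [Finset.disjoint_left]; simp only [b, d, Finset.mem_union, Finset.mem_sdiff]; tauto
  have hcd : Disjoint c d := by
    rw [Finset.disjoint_left]; simp only [c, d, Finset.mem_union, Finset.mem_sdiff]; tauto
  have e1 : S = a ∪ b := by
    ext v; simp only [a, b, Finset.mem_union, Finset.mem_inter, Finset.mem_sdiff]; tauto
  have e2 : T = a ∪ c := by
    ext v; simp only [a, c, Finset.mem_union, Finset.mem_inter, Finset.mem_sdiff]; tauto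
  have e3 : B \ S = c ∪ d := by
    ext v
    have := @hT v
    simp only [c, d, Finset.mem_union, Finset.mem_sdiff]; tauto
  have e4 : B \ T = b ∪ d := by
    ext v
    have := @hS v
    simp only [b, d, Finset.mem_union, Finset.mem_sdiff]; tauto
  have e5 : S ∪ T = a ∪ (b ∪ c) := by
    ext v
    simp only [a, b, c, Finset.mem_union, Finset.mem_inter, Finset.mem_sdiff]; tauto
  have e6 : B \ a = b ∪ (c ∪ d) := by
    ext v
    have h1 := @hS v
    have h2 := @hT v
    simp only [a, b, c, d, Finset.mem_union, Finset.mem_inter, Finset.mem_sdiff]; tauto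
  have habc : Disjoint a (b ∪ c) := Finset.disjoint_union_right.mpr ⟨hab, hac⟩
  have hbcd : Disjoint b (c ∪ d) := Finset.disjoint_union_right.mpr ⟨hbc, hbd⟩
  have f1 : G.cut B S = G.crossing a c + G.crossing a d + (G.crossing b c + G.crossing b d) := by
    unfold cut
    rw [e3]
    conv_lhs => rw [e1]
    rw [crossing_union_left hab, crossing_union_right _ hcd, crossing_union_right _ hcd]
  have f2 : G.cut B T = G.crossing a b + G.crossing a d + (G.crossing c b + G.crossing c d) := by
    unfold cut
    rw [e4]
    conv_lhs => rw [e2]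
    rw [crossing_union_left hac, crossing_union_right _ hbd, crossing_union_right _ hbd]
  have f3 : G.cut B (S ∪ T) = G.crossing a d + (G.crossing b d + G.crossing c d) := by
    unfold cut
    change G.crossing (S ∪ T) d = _
    rw [e5, crossing_union_left habc, crossing_union_left hbc]
  have f4 : G.cut B a = G.crossing a b + (G.crossing a c + G.crossing a d) := by
    unfold cut
    rw [e6, crossing_union_right _ hbcd, crossing_union_right _ hcd]
  rw [f1, f2, f3, f4]
  omega

/-- `G.Tight k r B S`: here `k = 3`, and `S` is a set avoiding the root `r` which is joined to the
rest of `G[B]` by exactly two edges.  For `k = 2` there are no tight sets. -/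
structure Tight (G : SimpleGraph V) (k : ℕ) (r : V) (B S : Finset V) : Prop where
  three : k = 3
  subset : S ⊆ B
  root : r ∉ S
  nonempty : S.Nonempty
  cut_eq : G.cut B S = 2

/-- `G.Admissible k r B`: the graph `G[B]` contains `r`, has no cut with fewer than two edges and, if
`k = 3`, tight sets consist of vertices of degree two.  For `k = 3` this says that `G[B]` is a
subdivision of a `3`-edge-connected multigraph having `r` among its vertices. -/
structure Admissible (G : SimpleGraph V) (k : ℕ) (r : V) (B : Finset V) : Prop where
  root : r ∈ B
  two_le : ∀ S ⊆ B, r ∉ S → S.Nonempty → 2 ≤ G.cut B S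
  degIn_eq : ∀ S, G.Tight k r B S → ∀ v ∈ S, G.degIn B v = 2

variable {k : ℕ} {r : V} {B : Finset V}

lemma Admissible.singleton (k : ℕ) (r : V) : G.Admissible k r {r} := by
  have h : ∀ S ⊆ ({r} : Finset V), r ∉ S → ¬ S.Nonempty := by
    rintro S hS hr ⟨s, hs⟩
    exact hr (Finset.mem_singleton.mp (hS hs) ▸ hs)
  exact ⟨by simp, fun S hS hr hne => absurd hne (h S hS hr),
    fun S hS => absurd hS.nonempty (h S hS.subset hS.root)⟩

lemma Admissible.tight_union (hB : G.Admissible k r B) {S T : Finset V} (hS : G.Tight k r B S)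
    (hT : G.Tight k r B T) (hST : (S ∩ T).Nonempty) : G.Tight k r B (S ∪ T) := by
  have hr : r ∉ S ∪ T := by
    rw [Finset.mem_union]
    exact fun h => h.elim hS.root hT.root
  have h1 := cut_union_add_cut_inter_le (G := G) hS.subset hT.subset
  have h2 := hB.two_le (S ∩ T) (Finset.inter_subset_left.trans hS.subset)
    (fun h => hS.root (Finset.mem_inter.mp h).1) hST
  have hsub := Finset.union_subset hS.subset hT.subset
  have hne := hS.nonempty.mono (Finset.subset_union_left (s₂ := T))
  have h3 := hB.two_le (S ∪ T) hsub hr hne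
  have h4 := hS.cut_eq
  have h5 := hT.cut_eq
  exact ⟨hS.three, hsub, hr, hne, by omega⟩

/-- Adding an "ear" `P` to an admissible set, that is, a set which behaves like the interior of a
path with both ends in `B` (first three hypotheses) and whose attachments to `B` do not all lie in
one tight set. -/
lemma Admissible.union_ear (hB : G.Admissible k r B) {P : Finset V} (hBP : Disjoint B P)
    (h1 : ∀ R ⊆ P, R.Nonempty → 2 ≤ G.crossing R (P \ R) + G.crossing R B)
    (h2 : ∀ R ⊆ P, G.crossing R (P \ R) + G.crossing R B = 2 →
      ∀ v ∈ R, G.degIn (B ∪ P) v = 2)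
    (h3 : ∀ R ⊆ P, R.Nonempty → R ≠ P → 0 < G.crossing R (P \ R))
    (h4 : ∀ S, G.Tight k r B S → 0 < G.crossing P (B \ S)) :
    G.Admissible k r (B ∪ P) := by
  have key : ∀ U ⊆ B ∪ P, r ∉ U → U.Nonempty → 2 ≤ G.cut (B ∪ P) U ∧
      (k = 3 → G.cut (B ∪ P) U = 2 → ∀ v ∈ U, G.degIn (B ∪ P) v = 2) := by
    intro U hU hrU hUne
    obtain ⟨S, R, hS, hR, rfl⟩ : ∃ S R, S ⊆ B ∧ R ⊆ P ∧ U = S ∪ R := by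
      refine ⟨U ∩ B, U ∩ P, Finset.inter_subset_right, Finset.inter_subset_right, ?_⟩
      rw [← Finset.inter_union_distrib_left, Finset.inter_eq_left.mpr hU]
    have hrS : r ∉ S := fun h => hrU (Finset.mem_union_left _ h)
    rw [cut_union hBP hS hR]
    rcases S.eq_empty_or_nonempty with rfl | hSne
    · have hRne : R.Nonempty := by simpa using hUne
      have h5 := h1 R hR hRne
      have h0 : G.cut B ∅ = 0 := by simp [cut]
      simp only [crossing_empty_left, Finset.sdiff_empty, Finset.empty_union, h0]
      refine ⟨by omega, fun _ he => h2 R hR (by omega)⟩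
    · have h5 := hB.two_le S hS hrS hSne
      refine ⟨by omega, fun hk he => ?_⟩
      have hT : G.Tight k r B S := ⟨hk, hS, hrS, hSne, by omega⟩
      rcases R.eq_empty_or_nonempty with rfl | hRne
      · intro v hv
        rw [Finset.union_empty] at hv
        rw [degIn_union hBP, hB.degIn_eq S hT v hv]
        have := degIn_le_crossing (G := G) P hv
        rw [Finset.sdiff_empty] at he
        omega
      · by_cases hRP : R = P
        · subst hRP
          have := h4 S hT
          omega
        · have := h3 R hR hRne hRP
          omega
  exact ⟨Finset.mem_union_left _ hB.root, fun U hU hr hne => (key U hU hr hne).1,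
    fun U hU => (key U hU.subset hU.root hU.nonempty).2 hU.three hU.cut_eq⟩

lemma Admissible.union_singleton (hB : G.Admissible k r B) {x : V} (hx : x ∉ B)
    (hdeg : 2 ≤ G.degIn B x) (h : ∀ S, G.Tight k r B S → ∃ y ∈ B, G.Adj x y ∧ y ∉ S) :
    G.Admissible k r (B ∪ {x}) := by
  have hsub : ∀ R ⊆ ({x} : Finset V), R.Nonempty → R = {x} := fun R hR hne =>
    (Finset.subset_singleton_iff.mp hR).resolve_left hne.ne_empty
  have hxx : G.degIn {x} x = 0 := by rw [degIn_singleton]; simp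
  refine hB.union_ear (Finset.disjoint_singleton_right.mpr hx) ?_ ?_ ?_ ?_
  · intro R hR hne
    rw [hsub R hR hne, crossing_singleton_left, crossing_singleton_left]
    omega
  · intro R hR he v hv
    have hR' := hsub R hR ⟨v, hv⟩
    subst hR'
    rw [Finset.mem_singleton] at hv
    subst hv
    rw [Finset.sdiff_self, crossing_empty_right, crossing_singleton_left] at he
    rw [degIn_union (Finset.disjoint_singleton_right.mpr hx)]
    omega
  · intro R hR hne hne'
    exact absurd (hsub R hR hne) hne'
  · intro S hS
    obtain ⟨y, hy, hxy, hyS⟩ := h S hS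
    exact crossing_pos_iff.mpr ⟨x, by simp, y, Finset.mem_sdiff.mpr ⟨hy, hyS⟩, hxy⟩

/-- Twice the cyclomatic number of `G[B]`, up to an additive constant. -/
noncomputable def excess (G : SimpleGraph V) (B : Finset V) : ℤ := ∑ v ∈ B, ((G.degIn B v : ℤ) - 2)

lemma excess_union {P : Finset V} (hBP : Disjoint B P) :
    G.excess (B ∪ P) = G.excess B + G.crossing P B + ∑ v ∈ P, ((G.degIn (B ∪ P) v : ℤ) - 2) := by
  have h1 : ∑ v ∈ B, ((G.degIn (B ∪ P) v : ℤ) - 2) = G.excess B + G.crossing P B := by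
    rw [crossing_comm, excess, crossing, Nat.cast_sum, ← Finset.sum_add_distrib]
    refine Finset.sum_congr rfl fun v _ => ?_
    rw [degIn_union hBP]
    push_cast
    ring
  rw [← h1]
  exact Finset.sum_union hBP

/-- A tight set of at least three vertices is a path.  If it is inclusion-minimal among the tight
sets containing all neighbours in `B` of a vertex `h`, then its two ends are adjacent to `h`. -/
lemma Admissible.exists_ends (hB : G.Admissible k r B) {S : Finset V} (hS : G.Tight k r B S)
    (hcard : 3 ≤ S.card) {h : V} (hhS : ∀ y ∈ B, G.Adj h y → y ∈ S)
    (hmin : ∀ S', G.Tight k r B S' → (∀ y ∈ B, G.Adj h y → y ∈ S') → S.card ≤ S'.card) :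
    ∃ s ∈ S, ∃ t ∈ S, s ≠ t ∧ G.Adj h s ∧ G.Adj h t ∧ ¬ G.Adj s t ∧
      G.degIn (B \ S) s = 1 ∧ G.degIn (B \ S) t = 1 ∧
      ∀ v ∈ S, v ≠ s → v ≠ t → G.degIn (B \ S) v = 0 := by
  have hdeg : ∀ v ∈ S, G.degIn (B \ S) v + G.degIn S v = 2 := fun v hv => by
    rw [degIn_sdiff_add hS.subset, hB.degIn_eq S hS v hv]
  have hcut : ∑ v ∈ S, G.degIn (B \ S) v = 2 := hS.cut_eq
  have herase : ∀ v ∈ S, G.cut B (S.erase v) + 2 * G.degIn (B \ S) v = 4 := by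
    intro v hv
    have h1 : B \ S.erase v = (B \ S) ∪ {v} := by
      ext w
      simp only [Finset.mem_sdiff, Finset.mem_erase, Finset.mem_union, Finset.mem_singleton]
      by_cases hw : w = v
      · subst hw
        simp [hS.subset hv]
      · simp [hw]
    have h2 : Disjoint (B \ S) {v} := by simp [hv]
    have h3 : G.crossing (S.erase v) {v} = G.degIn S v := by
      rw [crossing_comm, crossing_singleton_left]
      unfold degIn
      congr 1
      ext w
      simp only [Finset.mem_filter, Finset.mem_erase]
      exact ⟨fun h => ⟨h.1.2, h.2⟩, fun h => ⟨⟨h.2.ne', h.1⟩, h.2⟩⟩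
    have h4 : G.degIn (B \ S) v + G.crossing (S.erase v) (B \ S) = 2 := by
      rw [← hcut]
      exact Finset.add_sum_erase S _ hv
    have h5 := hdeg v hv
    unfold cut
    rw [h1, crossing_union_right _ h2, h3]
    omega
  have hle : ∀ v ∈ S, G.degIn (B \ S) v ≤ 1 := by
    intro v hv
    have h1 := herase v hv
    have h2 := hB.two_le (S.erase v) ((Finset.erase_subset _ _).trans hS.subset)
      (fun h => hS.root (Finset.mem_of_mem_erase h)) (by
        rw [← Finset.card_pos, Finset.card_erase_of_mem hv]
        omega)
    omega
  have hadj : ∀ v ∈ S, G.degIn (B \ S) v = 1 → G.Adj h v := by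
    intro v hv h1
    by_contra hna
    have h2 := herase v hv
    have h3 := hmin (S.erase v) ⟨hS.three, (Finset.erase_subset _ _).trans hS.subset,
      fun h => hS.root (Finset.mem_of_mem_erase h), by
        rw [← Finset.card_pos, Finset.card_erase_of_mem hv]
        omega, by omega⟩
      (fun y hy hhy => Finset.mem_erase.mpr ⟨fun h => hna (h ▸ hhy), hhS y hy hhy⟩)
    rw [Finset.card_erase_of_mem hv] at h3
    omega
  have hends : (S.filter (fun v => G.degIn (B \ S) v = 1)).card = 2 := by
    rw [← hcut, Finset.card_filter]
    refine Finset.sum_congr rfl fun v hv => ?_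
    have := hle v hv
    split_ifs <;> omega
  obtain ⟨s, t, hst, hE⟩ := Finset.card_eq_two.mp hends
  have hmem : ∀ v, (v ∈ S ∧ G.degIn (B \ S) v = 1) ↔ v = s ∨ v = t := by
    intro v
    have : v ∈ S.filter (fun v => G.degIn (B \ S) v = 1) ↔ v ∈ ({s, t} : Finset V) := by rw [hE]
    simpa using this
  obtain ⟨hsS, hs1⟩ := (hmem s).mpr (Or.inl rfl)
  obtain ⟨htS, ht1⟩ := (hmem t).mpr (Or.inr rfl)
  have hrest : ∀ v ∈ S, v ≠ s → v ≠ t → G.degIn (B \ S) v = 0 := by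
    intro v hv h1 h2
    have h3 := hle v hv
    have h4 : G.degIn (B \ S) v ≠ 1 := fun h => by
      rcases (hmem v).mp ⟨hv, h⟩ with h | h
      · exact h1 h
      · exact h2 h
    omega
  refine ⟨s, hsS, t, htS, hst, hadj s hsS hs1, hadj t htS ht1, fun hadj' => ?_, hs1, ht1, hrest⟩
  -- otherwise no edge of `G[B]` leaves `S \ {s, t}`
  have h1 := hB.two_le ((S.erase s).erase t)
    (((Finset.erase_subset _ _).trans (Finset.erase_subset _ _)).trans hS.subset)
    (fun h => hS.root (Finset.mem_of_mem_erase (Finset.mem_of_mem_erase h))) (by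
      rw [← Finset.card_pos, Finset.card_erase_of_mem
        (Finset.mem_erase.mpr ⟨hst.symm, htS⟩), Finset.card_erase_of_mem hsS]
      omega)
  obtain ⟨v, hv, y, hy, hvy⟩ := crossing_pos_iff.mp (lt_of_lt_of_le Nat.zero_lt_two h1)
  obtain ⟨hvt, hvs, hvS⟩ := by simpa only [Finset.mem_erase] using hv
  have hone : ∀ a b, a ∈ S → b ∈ S → G.degIn (B \ S) a = 1 → G.Adj a b → ∀ c ∈ S, G.Adj a c →
      c = b := by
    intro a b ha hb ha1 hab c hc hac
    have h2 := hdeg a ha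
    have h3 : (S.filter (G.Adj a)).card ≤ 1 := by
      unfold degIn at h2 ha1
      omega
    exact Finset.card_le_one.mp h3 c (Finset.mem_filter.mpr ⟨hc, hac⟩) b
      (Finset.mem_filter.mpr ⟨hb, hab⟩)
  by_cases hyS : y ∈ S
  · have hy' : y = s ∨ y = t := by
      by_contra hcon
      push Not at hcon
      exact (Finset.mem_sdiff.mp hy).2 (by simp [hcon.1, hcon.2, hyS])
    rcases hy' with rfl | rfl
    · exact hvt (hone y t hyS htS hs1 hadj' v hvS hvy.symm)
    · exact hvs (hone y s hyS hsS ht1 hadj'.symm v hvS hvy.symm)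
  · exact degIn_eq_zero_iff.mp (hrest v hvS hvs hvt) y
      (Finset.mem_sdiff.mpr ⟨(Finset.mem_sdiff.mp hy).1, hyS⟩) hvy

/-- The interior `S` of a path of `G[B]` with ends `s` and `t` can be replaced by the shorter path
`s h t`, where `h` has no neighbours outside `S`.  The tight sets through the new path correspond to
the tight sets through the old one. -/
lemma Admissible.replace (hB : G.Admissible k r B) {S : Finset V} (hS : G.Tight k r B S)
    {h s t : V} (hh : h ∉ B) (hhS : ∀ y ∈ B, G.Adj h y → y ∈ S) (hs : s ∈ S) (ht : t ∈ S)
    (hst : s ≠ t) (hhs : G.Adj h s) (hht : G.Adj h t) (hnst : ¬ G.Adj s t)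
    (hs1 : G.degIn (B \ S) s = 1) (ht1 : G.degIn (B \ S) t = 1)
    (hrest : ∀ v ∈ S, v ≠ s → v ≠ t → G.degIn (B \ S) v = 0) :
    G.Admissible k r ((B \ S) ∪ {s, h, t}) ∧
    G.excess ((B \ S) ∪ {s, h, t}) = G.excess B ∧
    ((B \ S) ∪ {s, h, t}).card + S.card = B.card + 3 ∧
    ∀ U, G.Tight k r ((B \ S) ∪ {s, h, t}) U → h ∈ U →
      ∃ T, G.Tight k r B T ∧ S ⊆ T ∧ U ∩ (B \ S) ⊆ T := by
  set B0 := B \ S with hB0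
  set Q : Finset V := {s, h, t} with hQ
  have hsh : s ≠ h := fun e => hh (e ▸ hS.subset hs)
  have hth : t ≠ h := fun e => hh (e ▸ hS.subset ht)
  have hBS : B = B0 ∪ S := (Finset.sdiff_union_of_subset hS.subset).symm
  have hB0S : Disjoint B0 S := Finset.sdiff_disjoint
  have hQmem : ∀ v, v ∈ Q ↔ v = s ∨ v = h ∨ v = t := by simp [hQ]
  have hB0Q : Disjoint B0 Q := by
    rw [Finset.disjoint_left]
    intro v hv hvQ
    rw [hB0, Finset.mem_sdiff] at hv
    rcases (hQmem v).mp hvQ with rfl | rfl | rfl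
    · exact hv.2 hs
    · exact hh hv.1
    · exact hv.2 ht
  have hh0 : G.degIn B0 h = 0 := degIn_eq_zero_iff.mpr fun y hy hhy =>
    (Finset.mem_sdiff.mp hy).2 (hhS y (Finset.mem_sdiff.mp hy).1 hhy)
  have hfil : ∀ w ∈ B0, Q.filter (G.Adj w) = S.filter (G.Adj w) := by
    intro w hw
    ext v
    simp only [Finset.mem_filter, hQmem]
    constructor
    · rintro ⟨rfl | rfl | rfl, hwv⟩
      · exact ⟨hs, hwv⟩
      · exact absurd hwv.symm (degIn_eq_zero_iff.mp hh0 w hw)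
      · exact ⟨ht, hwv⟩
    · rintro ⟨hv, hwv⟩
      refine ⟨?_, hwv⟩
      by_contra hcon
      push Not at hcon
      exact degIn_eq_zero_iff.mp (hrest v hv hcon.1 hcon.2.2) w hw hwv.symm
  have hdegQS : ∀ w ∈ B0, G.degIn Q w = G.degIn S w := fun w hw => by
    unfold degIn
    rw [hfil w hw]
  have hcrQS : ∀ W ⊆ B0, G.crossing W Q = G.crossing W S := fun W hW =>
    Finset.sum_congr rfl fun w hw => hdegQS w (hW hw)
  have hsumQ : ∀ F : V → ℕ, ∑ v ∈ Q, F v = F s + F h + F t := by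
    intro F
    rw [hQ, Finset.sum_insert (by simp [hsh, hst]), Finset.sum_pair hth.symm, add_assoc]
  have hcrR : ∀ R ⊆ Q, ∀ Y, G.crossing R Y = (if s ∈ R then G.degIn Y s else 0) +
      (if h ∈ R then G.degIn Y h else 0) + (if t ∈ R then G.degIn Y t else 0) := by
    intro R hR Y
    rw [← hsumQ (fun v => if v ∈ R then G.degIn Y v else 0), ← Finset.sum_filter,
      Finset.filter_mem_eq_inter, Finset.inter_eq_right.mpr hR]
    rfl
  have hdegQ : ∀ R v, G.degIn (Q \ R) v = (if s ∉ R ∧ G.Adj v s then 1 else 0) +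
      (if h ∉ R ∧ G.Adj v h then 1 else 0) + (if t ∉ R ∧ G.Adj v t then 1 else 0) := by
    intro R v
    rw [← hsumQ (fun u => if u ∉ R ∧ G.Adj v u then 1 else 0), ← Finset.card_filter]
    unfold degIn
    congr 1
    ext u
    simp only [Finset.mem_filter, Finset.mem_sdiff]
    tauto
  have hns : ¬ G.Adj t s := fun e => hnst e.symm
  have hdegQs : ∀ R, G.degIn (Q \ R) s = if h ∉ R then 1 else 0 := fun R => by
    simp [hdegQ, hhs.symm, hnst]
  have hdegQt : ∀ R, G.degIn (Q \ R) t = if h ∉ R then 1 else 0 := fun R => by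
    simp [hdegQ, hht.symm, hns]
  have hdegQh : ∀ R, G.degIn (Q \ R) h = (if s ∉ R then 1 else 0) + if t ∉ R then 1 else 0 :=
    fun R => by simp [hdegQ, hhs, hht]
  have hdeg2 : ∀ v ∈ Q, G.degIn (B0 ∪ Q) v = 2 := by
    intro v hv
    have e : Q = Q \ ∅ := by simp
    rw [degIn_union hB0Q]
    rcases (hQmem v).mp hv with rfl | rfl | rfl
    · rw [e, hdegQs, hs1]; simp
    · rw [e, hdegQh, hh0]; simp
    · rw [e, hdegQt, ht1]; simp
  have hdegB : ∀ v ∈ B0, G.degIn (B0 ∪ Q) v = G.degIn B v := by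
    intro v hv
    rw [degIn_union hB0Q, hdegQS v hv, ← degIn_union hB0S, ← hBS]
  have hr0 : r ∈ B0 := Finset.mem_sdiff.mpr ⟨hB.root, hS.root⟩
  have hcut0 : G.cut B0 ∅ = 0 := by simp [cut]
  have hsplit : ∀ U ⊆ B0 ∪ Q, ∃ W R, W ⊆ B0 ∧ R ⊆ Q ∧ U = W ∪ R := by
    intro U hU
    refine ⟨U ∩ B0, U ∩ Q, Finset.inter_subset_right, Finset.inter_subset_right, ?_⟩
    rw [← Finset.inter_union_distrib_left, Finset.inter_eq_left.mpr hU]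
  have hcutS : ∀ W ⊆ B0, G.cut B (W ∪ S) = G.cut B0 W + G.crossing Q (B0 \ W) := by
    intro W hW
    conv_lhs => rw [hBS]
    rw [cut_union hB0S hW subset_rfl, Finset.sdiff_self, crossing_empty_right,
      crossing_empty_right, crossing_comm S, ← hcrQS _ Finset.sdiff_subset, crossing_comm Q]
    omega
  -- every cut of the new graph is at least as large as a corresponding cut of the old one
  have hcmp : ∀ W ⊆ B0, ∀ R ⊆ Q, G.cut B W ≤ G.cut (B0 ∪ Q) (W ∪ R) ∨
      G.cut B (W ∪ S) ≤ G.cut (B0 ∪ Q) (W ∪ R) := by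
    intro W hW R hR
    have e1 : G.cut B W = G.cut B0 W + G.crossing Q W := by
      conv_lhs => rw [hBS, ← Finset.union_empty W]
      rw [cut_union hB0S hW (Finset.empty_subset _), Finset.sdiff_empty, ← hcrQS W hW,
        crossing_comm Q]
      simp
    have e2 := hcutS W hW
    have e3 := cut_union (G := G) hB0Q hW hR
    have hs' : G.degIn (B0 \ W) s + G.degIn W s = 1 := by rw [degIn_sdiff_add hW, hs1]
    have ht' : G.degIn (B0 \ W) t + G.degIn W t = 1 := by rw [degIn_sdiff_add hW, ht1]
    have hh' : G.degIn (B0 \ W) h + G.degIn W h = 0 := by rw [degIn_sdiff_add hW, hh0]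
    have hsQ : s ∈ Q := by simp [hQ]
    have hhQ : h ∈ Q := by simp [hQ]
    have htQ : t ∈ Q := by simp [hQ]
    rw [crossing_comm W, hcrR _ Finset.sdiff_subset, hcrR R hR, hcrR R hR, hdegQs, hdegQt,
      hdegQh] at e3
    rw [hcrR Q subset_rfl, if_pos hsQ, if_pos hhQ, if_pos htQ] at e1 e2
    by_cases c1 : s ∈ R <;> by_cases c2 : h ∈ R <;> by_cases c3 : t ∈ R <;>
      simp only [Finset.mem_sdiff, hsQ, hhQ, htQ, c1, c2, c3, not_true_eq_false,
        not_false_eq_true, and_true, and_false, if_true, if_false] at e3 <;> omega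
  have hadm : G.Admissible k r (B0 ∪ Q) := by
    refine ⟨Finset.mem_union_left _ hr0, ?_, ?_⟩
    · intro U hU hrU hUne
      obtain ⟨W, R, hW, hR, rfl⟩ := hsplit U hU
      rcases W.eq_empty_or_nonempty with rfl | hWne
      · have hRne : R.Nonempty := by simpa using hUne
        rw [cut_union hB0Q hW hR, hcut0, hcrR R hR, hcrR R hR, hdegQs, hdegQt, hdegQh,
          Finset.sdiff_empty, hs1, ht1, hh0]
        have hsome : s ∈ R ∨ h ∈ R ∨ t ∈ R := by
          obtain ⟨v, hv⟩ := hRne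
          rcases (hQmem v).mp (hR hv) with rfl | rfl | rfl
          · exact Or.inl hv
          · exact Or.inr (Or.inl hv)
          · exact Or.inr (Or.inr hv)
        by_cases c1 : s ∈ R <;> by_cases c2 : h ∈ R <;> by_cases c3 : t ∈ R <;>
          simp [c1, c2, c3] at hsome ⊢
      · have hrW : r ∉ W := fun e => hrU (Finset.mem_union_left _ e)
        have hWB : W ⊆ B := hW.trans Finset.sdiff_subset
        rcases hcmp W hW R hR with e | e
        · exact (hB.two_le W hWB hrW hWne).trans e
        · refine (hB.two_le (W ∪ S) (Finset.union_subset hWB hS.subset) ?_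
            (hWne.mono Finset.subset_union_left)).trans e
          rw [Finset.mem_union]
          exact fun e => e.elim hrW hS.root
    · intro U hU v hv
      rcases Finset.mem_union.mp (hU.subset hv) with hv0 | hvQ
      · rw [hdegB v hv0]
        obtain ⟨W, R, hW, hR, rfl⟩ := hsplit U hU.subset
        have hvW : v ∈ W := (Finset.mem_union.mp hv).resolve_right fun e =>
          Finset.disjoint_left.mp hB0Q hv0 (hR e)
        have hrW : r ∉ W := fun e => hU.root (Finset.mem_union_left _ e)
        have hWB : W ⊆ B := hW.trans Finset.sdiff_subset
        have hWS : W ∪ S ⊆ B := Finset.union_subset hWB hS.subset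
        have hrWS : r ∉ W ∪ S := by
          rw [Finset.mem_union]
          exact fun e => e.elim hrW hS.root
        have hcutU := hU.cut_eq
        rcases hcmp W hW R hR with e | e
        · have h2 := hB.two_le W hWB hrW ⟨v, hvW⟩
          exact hB.degIn_eq W ⟨hU.three, hWB, hrW, ⟨v, hvW⟩, by omega⟩ v hvW
        · have hvWS : v ∈ W ∪ S := Finset.mem_union_left _ hvW
          have h2 := hB.two_le _ hWS hrWS ⟨v, hvWS⟩
          exact hB.degIn_eq _ ⟨hU.three, hWS, hrWS, ⟨v, hvWS⟩, by omega⟩ v hvWS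
      · exact hdeg2 v hvQ
  refine ⟨hadm, ?_, ?_, ?_⟩
  · have e1 : ∑ v ∈ Q, ((G.degIn (B0 ∪ Q) v : ℤ) - 2) = 0 :=
      Finset.sum_eq_zero fun v hv => by rw [hdeg2 v hv]; norm_num
    have e2 : ∑ v ∈ S, ((G.degIn B v : ℤ) - 2) = 0 :=
      Finset.sum_eq_zero fun v hv => by rw [hB.degIn_eq S hS v hv]; norm_num
    have e3 : G.excess B = ∑ v ∈ B0, ((G.degIn B v : ℤ) - 2) + ∑ v ∈ S, ((G.degIn B v : ℤ) - 2) := by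
      rw [← Finset.sum_union hB0S, ← hBS]
      rfl
    rw [e3, e2, excess, Finset.sum_union hB0Q, e1]
    congr 1
    exact Finset.sum_congr rfl fun v hv => by rw [hdegB v hv]
  · have e1 : Q.card = 3 := Finset.card_eq_three.mpr ⟨s, h, t, hsh, hst, hth.symm, rfl⟩
    have e2 : B.card = B0.card + S.card := by
      conv_lhs => rw [hBS]
      exact Finset.card_union_of_disjoint hB0S
    rw [Finset.card_union_of_disjoint hB0Q, e1]
    omega
  · intro U hU hhU
    have hrQ : r ∉ Q := fun e => Finset.disjoint_left.mp hB0Q hr0 e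
    have hQt : G.Tight k r (B0 ∪ Q) Q := by
      refine ⟨hS.three, Finset.subset_union_right, hrQ, ⟨h, by simp [hQ]⟩, ?_⟩
      have e := cut_union (G := G) hB0Q (Finset.empty_subset B0) (subset_rfl : Q ⊆ Q)
      rw [Finset.empty_union, hcut0, Finset.sdiff_self, Finset.sdiff_empty] at e
      have e' : G.crossing Q B0 = 2 := by rw [crossing, hsumQ, hs1, ht1, hh0]
      rw [e, e']
      simp
    have hUQ := hadm.tight_union hU hQt ⟨h, Finset.mem_inter.mpr ⟨hhU, by simp [hQ]⟩⟩
    set W := U ∩ B0 with hW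
    have hWB0 : W ⊆ B0 := Finset.inter_subset_right
    have e1 : U ∪ Q = W ∪ Q := by
      ext v
      have h1 : v ∈ U → v ∈ B0 ∪ Q := fun e => hU.subset e
      simp only [hW, Finset.mem_union, Finset.mem_inter] at h1 ⊢
      constructor
      · rintro (e | e)
        · exact (h1 e).imp (fun e' => ⟨e, e'⟩) id
        · exact Or.inr e
      · rintro (e | e)
        · exact Or.inl e.1
        · exact Or.inr e
    have e2 := hUQ.cut_eq
    rw [e1, cut_union hB0Q hWB0 subset_rfl, Finset.sdiff_self] at e2
    have e3 := hcutS W hWB0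
    simp only [crossing_empty_right] at e2
    refine ⟨W ∪ S, ⟨hS.three, Finset.union_subset (hWB0.trans Finset.sdiff_subset) hS.subset, ?_,
      hS.nonempty.mono Finset.subset_union_right, by omega⟩, Finset.subset_union_right,
      Finset.subset_union_left⟩
    rw [Finset.mem_union]
    exact fun e => e.elim (fun e => hU.root (Finset.mem_inter.mp e).1) hS.root

end Cuts

end SimpleGraph

/-! ### Adding the vertices of a path to an admissible set -/

namespace SimpleGraph

section Ears

open scoped Classical

variable {V W : Type*} {G : SimpleGraph V} {k : ℕ} {r : V} {B : Finset V}

/-- A set of indices has at least one element whose successor is missing. -/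
lemma card_filter_succ_lt {I : Finset ℕ} (hI : I.Nonempty) :
    (I.filter (fun i => i + 1 ∈ I)).card < I.card := by
  refine Finset.card_lt_card ((Finset.filter_ssubset).mpr ⟨I.max' hI, I.max'_mem hI, fun h => ?_⟩)
  have := I.le_max' _ h
  omega

/-- A set of indices has at least one element whose predecessor is missing. -/
lemma card_filter_pred_lt {I : Finset ℕ} (hI : I.Nonempty) :
    (I.filter (fun i => ∃ j ∈ I, j + 1 = i)).card < I.card := by
  refine Finset.card_lt_card ((Finset.filter_ssubset).mpr ⟨I.min' hI, I.min'_mem hI, ?_⟩)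
  rintro ⟨j, hj, hji⟩
  have := I.min'_le _ hj
  omega

/-- An induced path whose two ends have neighbours `q` and `q'` in the admissible set `B` can be
added to `B`, unless `q` and `q'` lie in a common tight set. -/
lemma Admissible.union_path (hB : G.Admissible k r B) {h : ℕ → V} {d : ℕ} (hd : 1 ≤ d)
    (hout : ∀ i ≤ d, h i ∉ B) (hinj : ∀ i ≤ d, ∀ j ≤ d, h i = h j → i = j)
    (hadj : ∀ i < d, G.Adj (h i) (h (i + 1)))
    (hchord : ∀ i ≤ d, ∀ j ≤ d, G.Adj (h i) (h j) → i + 1 = j ∨ j + 1 = i)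
    {q q' : V} (hq : q ∈ B) (hq' : q' ∈ B) (h0q : G.Adj (h 0) q) (hdq : G.Adj (h d) q')
    (hqq : ∀ S, G.Tight k r B S → q ∈ S → q' ∉ S) :
    G.Admissible k r (B ∪ (Finset.range (d + 1)).image h) ∧
      G.excess B < G.excess (B ∪ (Finset.range (d + 1)).image h) := by
  set P := (Finset.range (d + 1)).image h with hP
  have hPmem : ∀ i ≤ d, h i ∈ P := fun i hi =>
    Finset.mem_image_of_mem h (Finset.mem_range.mpr (by omega))
  have hPex : ∀ v ∈ P, ∃ i ≤ d, h i = v := by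
    intro v hv
    obtain ⟨i, hi, rfl⟩ := Finset.mem_image.mp hv
    exact ⟨i, by rw [Finset.mem_range] at hi; omega, rfl⟩
  have hBP : Disjoint B P := by
    rw [Finset.disjoint_right]
    intro v hv
    obtain ⟨i, hi, rfl⟩ := hPex v hv
    exact hout i hi
  have hends : ∀ v ∈ P, 2 ≤ G.degIn P v + G.degIn B v := by
    intro v hv
    obtain ⟨i, hi, rfl⟩ := hPex v hv
    have hl : 1 ≤ i → 0 < G.degIn {h (i - 1)} (h i) := fun h1 => by
      have := hadj (i - 1) (by omega)
      rw [Nat.sub_add_cancel h1] at this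
      exact degIn_pos_iff.mpr ⟨_, by simp, this.symm⟩
    have hr : i < d → 0 < G.degIn {h (i + 1)} (h i) := fun h1 =>
      degIn_pos_iff.mpr ⟨_, by simp, hadj i h1⟩
    by_cases h1 : i = 0
    · subst h1
      have e1 : 0 < G.degIn B (h 0) := degIn_pos_iff.mpr ⟨q, hq, h0q⟩
      have e2 := hr (by omega)
      have e3 : G.degIn {h (0 + 1)} (h 0) ≤ G.degIn P (h 0) :=
        degIn_mono (Finset.singleton_subset_iff.mpr (hPmem _ (by omega))) _
      omega
    · by_cases h2 : i = d
      · subst h2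
        have e1 : 0 < G.degIn B (h i) := degIn_pos_iff.mpr ⟨q', hq', hdq⟩
        have e2 := hl (by omega)
        have e3 : G.degIn {h (i - 1)} (h i) ≤ G.degIn P (h i) :=
          degIn_mono (Finset.singleton_subset_iff.mpr (hPmem _ (by omega))) _
        omega
      · have e1 := hl (by omega)
        have e2 := hr (by omega)
        have e3 : G.degIn ({h (i - 1)} ∪ {h (i + 1)}) (h i) ≤ G.degIn P (h i) :=
          degIn_mono (Finset.union_subset
            (Finset.singleton_subset_iff.mpr (hPmem _ (by omega)))
            (Finset.singleton_subset_iff.mpr (hPmem _ (by omega)))) _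
        rw [degIn_union (by
          rw [Finset.disjoint_singleton]
          intro e
          have := hinj _ (by omega) _ (by omega) e
          omega)] at e3
        omega
  -- a nonempty set of vertices of the path spans a forest
  have hforest : ∀ R ⊆ P, R.Nonempty → G.crossing R R + 2 ≤ 2 * R.card := by
    intro R hR hne
    set I := (Finset.range (d + 1)).filter (fun i => h i ∈ R) with hI
    have hImem : ∀ i, i ∈ I ↔ i ≤ d ∧ h i ∈ R := by
      intro i
      rw [hI, Finset.mem_filter, Finset.mem_range, Nat.lt_succ_iff]
    have hRI : R = I.image h := by
      ext v
      constructor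
      · intro hv
        obtain ⟨i, hi, rfl⟩ := hPex v (hR hv)
        exact Finset.mem_image_of_mem _ ((hImem i).mpr ⟨hi, hv⟩)
      · intro hv
        obtain ⟨i, hi, rfl⟩ := Finset.mem_image.mp hv
        exact ((hImem i).mp hi).2
    have hIinj : Set.InjOn h I := fun i hi j hj e =>
      hinj i ((hImem i).mp hi).1 j ((hImem j).mp hj).1 e
    have hcard : R.card = I.card := by
      conv_lhs => rw [hRI]
      exact Finset.card_image_of_injOn hIinj
    have hIne : I.Nonempty := by
      rw [← Finset.card_pos, ← hcard]
      exact Finset.card_pos.mpr hne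
    have hle : ∀ i ∈ I, G.degIn R (h i) ≤
        (if i + 1 ∈ I then 1 else 0) + if ∃ j ∈ I, j + 1 = i then 1 else 0 := by
      intro i hi
      have hsub : R.filter (G.Adj (h i)) ⊆
          (if i + 1 ∈ I then {h (i + 1)} else ∅) ∪
            if ∃ j ∈ I, j + 1 = i then {h (i - 1)} else ∅ := by
        intro v hv
        obtain ⟨hvR, hiv⟩ := Finset.mem_filter.mp hv
        obtain ⟨j, hj, rfl⟩ := hPex v (hR hvR)
        have hjI : j ∈ I := (hImem j).mpr ⟨hj, hvR⟩
        rw [Finset.mem_union]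
        rcases hchord i ((hImem i).mp hi).1 j hj hiv with e | e
        · left
          subst e
          rw [if_pos hjI]
          simp
        · right
          rw [if_pos ⟨j, hjI, e⟩]
          subst e
          simp
      refine (Finset.card_le_card hsub).trans ((Finset.card_union_le _ _).trans ?_)
      split_ifs <;> simp
    have hsum : G.crossing R R = ∑ i ∈ I, G.degIn R (h i) := by
      unfold crossing
      conv_lhs => rw [hRI]
      rw [Finset.sum_image hIinj, ← hRI]
    have h1 := Finset.sum_le_sum hle
    rw [Finset.sum_add_distrib, ← Finset.card_filter, ← Finset.card_filter, ← hsum] at h1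
    have h2 := card_filter_succ_lt hIne
    have h3 := card_filter_pred_lt hIne
    omega
  have hsplit : ∀ R ⊆ P, G.crossing R (P \ R) + G.crossing R B + G.crossing R R =
      ∑ v ∈ R, (G.degIn P v + G.degIn B v) := by
    intro R hR
    unfold crossing
    rw [← Finset.sum_add_distrib, ← Finset.sum_add_distrib]
    refine Finset.sum_congr rfl fun v _ => ?_
    rw [← degIn_sdiff_add hR v]
    omega
  have hsumge : ∀ R ⊆ P, 2 * R.card ≤ ∑ v ∈ R, (G.degIn P v + G.degIn B v) := by
    intro R hR
    rw [mul_comm, ← smul_eq_mul]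
    exact Finset.card_nsmul_le_sum _ _ _ fun v hv => hends v (hR hv)
  refine ⟨hB.union_ear hBP ?_ ?_ ?_ ?_, ?_⟩
  · intro R hR hne
    have h1 := hforest R hR hne
    have h2 := hsplit R hR
    have h3 := hsumge R hR
    omega
  · intro R hR he v hv
    have h1 := hforest R hR ⟨v, hv⟩
    have h2 := hsplit R hR
    rw [degIn_union hBP]
    have h4 := hends v (hR hv)
    have h5 := hsumge (R.erase v) ((Finset.erase_subset _ _).trans hR)
    have h6 := Finset.add_sum_erase R (fun v => G.degIn P v + G.degIn B v) hv
    have h7 := Finset.card_erase_add_one hv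
    omega
  · intro R hR hne hRP
    by_contra hcon
    -- membership in `R` is constant along the path
    have hiff : ∀ i < d, (h i ∈ R ↔ h (i + 1) ∈ R) := by
      intro i hi
      have e1 := hPmem i hi.le
      have e2 := hPmem (i + 1) hi
      constructor
      · intro e
        by_contra e'
        exact hcon (crossing_pos_iff.mpr ⟨_, e, _, Finset.mem_sdiff.mpr ⟨e2, e'⟩, hadj i hi⟩)
      · intro e
        by_contra e'
        exact hcon (crossing_pos_iff.mpr ⟨_, e, _, Finset.mem_sdiff.mpr ⟨e1, e'⟩,
          (hadj i hi).symm⟩)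
    have hall : ∀ i ≤ d, (h 0 ∈ R ↔ h i ∈ R) := by
      intro i
      induction i with
      | zero => simp
      | succ i ih => exact fun hi => (ih (by omega)).trans (hiff i (by omega))
    obtain ⟨v, hv⟩ := hne
    obtain ⟨i, hi, rfl⟩ := hPex v (hR hv)
    refine hRP (Finset.Subset.antisymm hR fun u hu => ?_)
    obtain ⟨j, hj, rfl⟩ := hPex u hu
    exact (hall j hj).mp ((hall i hi).mpr hv)
  · intro S hS
    by_cases e : q ∈ S
    · exact crossing_pos_iff.mpr ⟨h d, hPmem d le_rfl, q', Finset.mem_sdiff.mpr ⟨hq', hqq S hS e⟩,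
        hdq⟩
    · exact crossing_pos_iff.mpr ⟨h 0, hPmem 0 (by omega), q, Finset.mem_sdiff.mpr ⟨hq, e⟩, h0q⟩
  · rw [excess_union hBP]
    have h1 : 0 < G.crossing P B :=
      crossing_pos_iff.mpr ⟨h 0, hPmem 0 (by omega), q, hq, h0q⟩
    have h2 : 0 ≤ ∑ v ∈ P, ((G.degIn (B ∪ P) v : ℤ) - 2) := by
      refine Finset.sum_nonneg fun v hv => ?_
      have := hends v hv
      rw [degIn_union hBP]
      push_cast
      omega
    omega

/-- The graph on all vertices whose edges are the edges of `G[H]`. -/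
def within (G : SimpleGraph V) (H : Finset V) : SimpleGraph V where
  Adj a b := G.Adj a b ∧ a ∈ H ∧ b ∈ H
  symm := ⟨fun _ _ h => ⟨h.1.symm, h.2.2, h.2.1⟩⟩
  loopless := ⟨fun _ h => G.loopless.irrefl _ h.1⟩

lemma exists_walk_of_chain {K : SimpleGraph V} (h : ℕ → V) {i j : ℕ} (hij : i ≤ j)
    (hc : ∀ l, i ≤ l → l < j → K.Adj (h l) (h (l + 1))) :
    ∃ p : K.Walk (h i) (h j), p.length = j - i := by
  induction j, hij using Nat.le_induction with
  | base => exact ⟨Walk.nil, by simp⟩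
  | succ j hj ih =>
    obtain ⟨p, hp⟩ := ih fun l h1 h2 => hc l h1 (by omega)
    exact ⟨p.concat (hc j hj (by omega)), by rw [Walk.length_concat, hp]; omega⟩

end Ears

end SimpleGraph

/-! ### Optimal admissible sets and their ears -/

namespace SimpleGraph

section Absorbing

open scoped Classical

variable {V W : Type*} {G : SimpleGraph V} {T : SimpleGraph W} {k : ℕ} {r : V} {B : Finset V}

lemma degIn_le_of_forall_mem {S : Finset V} {x : V} (h : ∀ y ∈ B, G.Adj x y → y ∈ S) :
    G.degIn B x ≤ S.card :=
  Finset.card_le_card fun y hy => h y (Finset.mem_filter.mp hy).1 (Finset.mem_filter.mp hy).2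

lemma two_le_degIn {Y : Finset V} {x a b : V} (ha : a ∈ Y) (hb : b ∈ Y) (hab : a ≠ b)
    (hxa : G.Adj x a) (hxb : G.Adj x b) : 2 ≤ G.degIn Y x :=
  Finset.one_lt_card.mpr ⟨a, Finset.mem_filter.mpr ⟨ha, hxa⟩, b, Finset.mem_filter.mpr ⟨hb, hxb⟩,
    hab⟩

lemma mem_of_within_reachable {H : Finset V} {x y : V} (h : (G.within H).Reachable x y)
    (hx : x ∈ H) : y ∈ H := by
  obtain ⟨p⟩ := h
  induction p with
  | nil => exact hx
  | cons hadj _ ih => exact ih hadj.2.2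

variable [Fintype V]

/-- An admissible set leaves room for `T` if its complement contains a copy of `T`. -/
structure Roomy (T : SimpleGraph W) (G : SimpleGraph V) (k : ℕ) (r : V) (B : Finset V) : Prop where
  adm : G.Admissible k r B
  fits : T.FitsIn G Bᶜ

/-- An admissible set with room for `T` of largest possible cyclomatic number and, subject to
that, with as few vertices as possible. -/
structure Optimal (T : SimpleGraph W) (G : SimpleGraph V) (k : ℕ) (r : V) (B : Finset V) : Prop
    extends Roomy T G k r B where
  excess_le : ∀ B', T.Roomy G k r B' → G.excess B' ≤ G.excess B
  card_le : ∀ B', T.Roomy G k r B' → G.excess B' = G.excess B → B.card ≤ B'.card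

lemma exists_optimal (h : ∃ B, T.Roomy G k r B) : ∃ B, T.Optimal G k r B := by
  obtain ⟨B0, hB0⟩ := h
  obtain ⟨B1, hB1, hmax⟩ := Finset.exists_max_image
    (Finset.univ.filter (fun B => T.Roomy G k r B)) G.excess ⟨B0, by simpa using hB0⟩
  simp only [Finset.mem_filter, Finset.mem_univ, true_and] at hB1 hmax
  obtain ⟨B, hB, hmin⟩ := Finset.exists_min_image
    (Finset.univ.filter (fun B => T.Roomy G k r B ∧ G.excess B = G.excess B1)) Finset.card
    ⟨B1, by simpa using hB1⟩
  simp only [Finset.mem_filter, Finset.mem_univ, true_and, and_imp] at hB hmin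
  exact ⟨B, hB.1, fun B' hB' => hB.2 ▸ hmax B' hB', fun B' hB' he => hmin B' hB' (he.trans hB.2)⟩

lemma degIn_add_degIn_compl (B : Finset V) (v : V) :
    G.degIn B v + G.degIn Bᶜ v = G.degIn Finset.univ v := by
  rw [← degIn_union disjoint_compl_right, Finset.union_compl]

/-- If a vertex `x` outside an optimal set `B` is not needed for a copy of `T` and has two
neighbours in `B`, then all these neighbours lie on one short tight path, for otherwise `B` could
be improved by adding `x` or by a shortcut through `x`. -/
lemma Optimal.exists_tight (hB : T.Optimal G k r B) {x : V} (hx : x ∉ B)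
    (hfit : T.FitsIn G (Bᶜ.erase x)) (hdeg : 2 ≤ G.degIn B x) :
    ∃ S, G.Tight k r B S ∧ (∀ y ∈ B, G.Adj x y → y ∈ S) ∧ S.card ≤ 3 ∧
      ∀ S', G.Tight k r B S' → (∀ y ∈ B, G.Adj x y → y ∈ S') → S.card ≤ S'.card := by
  have hex : ∃ S, G.Tight k r B S ∧ ∀ y ∈ B, G.Adj x y → y ∈ S := by
    by_contra hcon
    push Not at hcon
    have hd : Disjoint B {x} := Finset.disjoint_singleton_right.mpr hx
    have h1 := hB.adm.union_singleton hx hdeg hcon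
    have h2 : Bᶜ.erase x = (B ∪ {x})ᶜ := by
      ext v
      simp only [Finset.mem_erase, Finset.mem_compl, Finset.mem_union, Finset.mem_singleton]
      tauto
    have h3 := hB.excess_le _ ⟨h1, h2 ▸ hfit⟩
    rw [excess_union hd, crossing_singleton_left, Finset.sum_singleton, degIn_union hd] at h3
    push_cast at h3
    omega
  obtain ⟨S, hS, hmin⟩ := Finset.exists_min_image
    (Finset.univ.filter (fun S => G.Tight k r B S ∧ ∀ y ∈ B, G.Adj x y → y ∈ S)) Finset.card
    (hex.imp fun S hS => by simpa using hS)
  simp only [Finset.mem_filter, Finset.mem_univ, true_and, and_imp] at hS hmin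
  refine ⟨S, hS.1, hS.2, ?_, hmin⟩
  by_contra hcard
  obtain ⟨s, hs, t, ht, hst, hxs, hxt, hnst, hs1, ht1, hrest⟩ :=
    hB.adm.exists_ends hS.1 (by omega) hS.2 hmin
  obtain ⟨h1, h2, h3, -⟩ := hB.adm.replace hS.1 hx hS.2 hs ht hst hxs hxt hnst hs1 ht1 hrest
  have h4 := hB.card_le _ ⟨h1, hfit.mono ?_⟩ h2
  · omega
  · intro v hv
    simp only [Finset.mem_erase, Finset.mem_compl, Finset.mem_union, Finset.mem_sdiff,
      Finset.mem_insert, Finset.mem_singleton] at hv ⊢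
    have e1 : v ≠ s := fun e => hv.2 (e ▸ hS.1.subset hs)
    have e2 : v ≠ t := fun e => hv.2 (e ▸ hS.1.subset ht)
    tauto

/-- No vertex outside an optimal set has many neighbours in it, unless the complement is just a
copy of `T`. -/
lemma Optimal.degIn_le [Fintype W] (hB : T.Optimal G k r B) (hT : T.IsTree) (hk : 2 ≤ k)
    (hdeg : ∀ v, Fintype.card W + k ≤ G.degIn Finset.univ v)
    (hfree : ∀ f : W → V, Function.Injective f → (∀ a b, T.Adj a b → G.Adj (f a) (f b)) →
      (∀ w, f w ∉ B) → ∃ c ∉ B, ∀ w, f w ≠ c) (x : V) (hx : x ∉ B) : G.degIn B x ≤ k := by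
  by_contra hcon
  obtain ⟨f, hinj, hhom, hfB⟩ := hB.fits
  obtain ⟨c, hc, hcf⟩ := hfree f hinj hhom fun w => by simpa using hfB w
  obtain ⟨y, hy, hfit⟩ := hT.exists_fitsIn_erase (H := Bᶜ)
    (X := Bᶜ.filter (fun v => k < G.degIn B v))
    ⟨x, by simp only [Finset.mem_filter, Finset.mem_compl]; exact ⟨hx, by omega⟩⟩
    (fun v hv hvX => by
      simp only [Finset.mem_filter, not_and] at hvX
      have h1 := hvX hv
      have h2 := hdeg v
      have h3 := degIn_add_degIn_compl (G := G) B v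
      omega)
    hinj hhom hfB ⟨c, by simpa using hc, hcf⟩
  simp only [Finset.mem_filter, Finset.mem_compl] at hy
  obtain ⟨S, hS, hyS, hcard, -⟩ := hB.exists_tight hy.1 hfit (by omega)
  have h1 := degIn_le_of_forall_mem hyS
  have h2 := hS.three
  omega

/-- An optimal set `B` such that every vertex outside `B` has at most `k` neighbours in `B` and can
be avoided by a copy of `T` outside `B`.  Every optimal set whose complement is not merely a copy of
`T` is of this kind, and the aim is to show that there are none. -/
structure Stuck (T : SimpleGraph W) (G : SimpleGraph V) (k : ℕ) (r : V) (B : Finset V) : Prop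
    extends Optimal T G k r B where
  degIn_le : ∀ x ∉ B, G.degIn B x ≤ k
  fits_erase : ∀ x ∉ B, T.FitsIn G (Bᶜ.erase x)

lemma Optimal.stuck [Fintype W] (hB : T.Optimal G k r B) (hT : T.IsTree) (hk : 2 ≤ k)
    (hdeg : ∀ v, Fintype.card W + k ≤ G.degIn Finset.univ v)
    (hfree : ∀ f : W → V, Function.Injective f → (∀ a b, T.Adj a b → G.Adj (f a) (f b)) →
      (∀ w, f w ∉ B) → ∃ c ∉ B, ∀ w, f w ≠ c) : T.Stuck G k r B := by
  have h1 := hB.degIn_le hT hk hdeg hfree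
  have h2 : ∀ x ∉ B, Fintype.card W ≤ G.degIn Bᶜ x := fun x hx => by
    have := h1 x hx
    have := hdeg x
    have := degIn_add_degIn_compl (G := G) B x
    omega
  have : Nonempty W := hT.connected.nonempty
  have hpos : 0 < Fintype.card W := Fintype.card_pos
  refine ⟨hB, h1, fun x hx => hT.fitsIn_of_degIn ?_ ?_⟩
  · obtain ⟨y, hy, hxy⟩ := degIn_pos_iff.mp (hpos.trans_le (h2 x hx))
    exact ⟨y, Finset.mem_erase.mpr ⟨hxy.ne', hy⟩⟩
  · intro y hy
    have h3 := h2 y (by simpa using Finset.mem_of_mem_erase hy)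
    unfold degIn at h3 ⊢
    rw [Finset.filter_erase]
    have := Finset.pred_card_le_card_erase (s := Bᶜ.filter (G.Adj y)) (a := x)
    omega

lemma Stuck.exists_tight (hB : T.Stuck G k r B) {x : V} (hx : x ∉ B) (hdeg : 2 ≤ G.degIn B x) :
    ∃ S, G.Tight k r B S ∧ ∀ y ∈ B, G.Adj x y → y ∈ S := by
  obtain ⟨S, h1, h2, -⟩ := hB.toOptimal.exists_tight hx (hB.fits_erase x hx) hdeg
  exact ⟨S, h1, h2⟩

/-- A vertex `u` outside `B` with three neighbours in `B` can be exchanged with the middle one of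
them: this gives another optimal set, and `u` takes over the role of its neighbour `a`. -/
lemma Stuck.swap (hB : T.Stuck G k r B) {u a q : V} (hu : u ∉ B) (hdeg : 3 ≤ G.degIn B u)
    (ha : a ∈ B) (hua : G.Adj u a) (hq : q ∈ B) (haq : ∀ S, G.Tight k r B S → a ∈ S → q ∉ S) :
    ∃ B', T.Optimal G k r B' ∧ u ∈ B' ∧ q ∈ B' ∧ (∀ S, G.Tight k r B' S → u ∈ S → q ∉ S) ∧
      Bᶜ.erase u ⊆ B'ᶜ := by
  obtain ⟨S, hS, huS, hcard, hmin⟩ :=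
    hB.toOptimal.exists_tight hu (hB.fits_erase u hu) (by omega)
  have hcard' := degIn_le_of_forall_mem huS
  obtain ⟨s, hs, t, ht, hst, hus, hut, hnst, hs1, ht1, hrest⟩ :=
    hB.adm.exists_ends hS (by omega) huS hmin
  obtain ⟨h1, h2, h3, h4⟩ := hB.adm.replace hS hu huS hs ht hst hus hut hnst hs1 ht1 hrest
  have haS := huS a ha hua
  have hqS : q ∈ B \ S := Finset.mem_sdiff.mpr ⟨hq, haq S hS haS⟩
  have hsub : Bᶜ.erase u ⊆ ((B \ S) ∪ {s, u, t})ᶜ := by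
    intro v hv
    simp only [Finset.mem_erase, Finset.mem_compl, Finset.mem_union, Finset.mem_sdiff,
      Finset.mem_insert, Finset.mem_singleton] at hv ⊢
    have e1 : v ≠ s := fun e => hv.2 (e ▸ hS.subset hs)
    have e2 : v ≠ t := fun e => hv.2 (e ▸ hS.subset ht)
    tauto
  refine ⟨(B \ S) ∪ {s, u, t}, ⟨⟨h1, (hB.fits_erase u hu).mono hsub⟩, ?_, ?_⟩, by simp,
    Finset.mem_union_left _ hqS, ?_, hsub⟩
  · intro B' hB'
    rw [h2]
    exact hB.excess_le B' hB'
  · intro B' hB' he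
    have := hB.card_le B' hB' (he.trans h2)
    omega
  · intro U hU huU hqU
    obtain ⟨X, hX, hSX, hUX⟩ := h4 U hU huU
    exact haq X hX (hSX haS) (hUX (Finset.mem_inter.mpr ⟨hqU, hqS⟩))

/-- The ends `x` and `y` of a path outside `B` which have neighbours in `B` not lying in a common
tight set. -/
structure EarPair (G : SimpleGraph V) (k : ℕ) (r : V) (B : Finset V) (x y : V) : Prop where
  left : x ∉ B
  right : y ∉ B
  ne : x ≠ y
  reach : (G.within Bᶜ).Reachable x y
  ends : ∃ q ∈ B, ∃ q' ∈ B, G.Adj x q ∧ G.Adj y q' ∧ ∀ S, G.Tight k r B S → q ∈ S → q' ∉ S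

/-- In a `k`-edge-connected graph there are ears. -/
lemma Stuck.exists_earPair (hB : T.Stuck G k r B) (hk : 2 ≤ k)
    (hcut : ∀ S : Finset V, r ∉ S → S.Nonempty → k ≤ G.cut Finset.univ S) {c : V} (hc : c ∉ B) :
    ∃ x y, G.EarPair k r B x y := by
  by_contra hno
  push Not at hno
  by_cases hex : ∃ S, G.Tight k r B S
  · -- a largest tight set together with the components attached to it violates the cut condition
    obtain ⟨S, hS, hmax⟩ := Finset.exists_max_image
      (Finset.univ.filter (fun S => G.Tight k r B S)) Finset.card
      (hex.imp fun S hS => by simpa using hS)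
    simp only [Finset.mem_filter, Finset.mem_univ, true_and] at hS hmax
    have hsep : ∀ s ∈ S, ∀ q ∉ S, ∀ X, G.Tight k r B X → s ∈ X → q ∉ X := by
      intro s hs q hq X hX hsX hqX
      have h1 := hmax _ (hB.adm.tight_union hS hX ⟨s, Finset.mem_inter.mpr ⟨hs, hsX⟩⟩)
      have h2 := Finset.eq_of_subset_of_card_le (Finset.subset_union_left (s₁ := S) (s₂ := X)) h1
      exact hq (h2 ▸ Finset.mem_union_right _ hqX)
    set C := Finset.univ.filter (fun v => v ∉ B ∧ ∃ s ∈ S, ∃ x, x ∉ B ∧ G.Adj x s ∧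
      (G.within Bᶜ).Reachable x v) with hC
    have hCmem : ∀ v, v ∈ C ↔ v ∉ B ∧ ∃ s ∈ S, ∃ x, x ∉ B ∧ G.Adj x s ∧
      (G.within Bᶜ).Reachable x v := by simp [hC]
    have hSC : Disjoint S C := Finset.disjoint_left.mpr fun v hv hv' =>
      ((hCmem v).mp hv').1 (hS.subset hv)
    have hrC : r ∉ S ∪ C := by
      rw [Finset.mem_union]
      exact fun e => e.elim hS.root fun e => ((hCmem r).mp e).1 hB.adm.root
    have h1 := hcut _ hrC (hS.nonempty.mono Finset.subset_union_left)
    have h2 : G.crossing C (Finset.univ \ (S ∪ C)) = 0 := by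
      by_contra hne
      obtain ⟨v, hv, y, hy, hvy⟩ := crossing_pos_iff.mp (Nat.pos_of_ne_zero hne)
      obtain ⟨hvB, s, hs, x, hx, hxs, hxv⟩ := (hCmem v).mp hv
      rw [Finset.mem_sdiff, Finset.mem_union] at hy
      push Not at hy
      by_cases hyB : y ∈ B
      · by_cases hxv' : x = v
        · subst hxv'
          have hsy : s ≠ y := fun e => hy.2.1 (e ▸ hs)
          obtain ⟨X, hX, hxX⟩ := hB.exists_tight hx
            (two_le_degIn (hS.subset hs) hyB hsy hxs hvy)
          exact hsep s hs y hy.2.1 X hX (hxX s (hS.subset hs) hxs) (hxX y hyB hvy)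
        · exact hno x v ⟨hx, hvB, hxv', hxv, s, hS.subset hs, y, hyB, hxs, hvy,
            hsep s hs y hy.2.1⟩
      · refine hy.2.2 ((hCmem y).mpr ⟨hyB, s, hs, x, hx, hxs, hxv.trans ?_⟩)
        exact Adj.reachable ⟨hvy, by simpa using hvB, by simpa using hyB⟩
    have h3 : G.crossing S (Finset.univ \ (S ∪ C)) ≤ G.crossing S (B \ S) := by
      refine Finset.sum_le_sum fun s hs => Finset.card_le_card fun y hy => ?_
      simp only [Finset.mem_filter, Finset.mem_sdiff, Finset.mem_union, not_or,
        Finset.mem_univ, true_and] at hy ⊢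
      refine ⟨⟨?_, hy.1.1⟩, hy.2⟩
      by_contra hyB
      exact hy.1.2 ((hCmem y).mpr ⟨hyB, s, hs, y, hyB, hy.2.symm, Reachable.refl _⟩)
    have h4 := hS.cut_eq
    have h5 := hS.three
    unfold cut at h1 h4
    rw [crossing_union_left hSC, h2] at h1
    omega
  · push Not at hex
    have hone : ∀ x ∉ B, G.degIn B x ≤ 1 := by
      intro x hx
      by_contra hcon
      obtain ⟨S, hS, -⟩ := hB.exists_tight hx (by omega)
      exact hex S hS
    set C := Finset.univ.filter (fun v => (G.within Bᶜ).Reachable c v) with hC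
    have hCmem : ∀ v, v ∈ C ↔ (G.within Bᶜ).Reachable c v := by simp [hC]
    have hCB : ∀ v ∈ C, v ∉ B := fun v hv => by
      simpa using mem_of_within_reachable ((hCmem v).mp hv) (by simpa using hc)
    have h1 := hcut C (fun e => hCB r e hB.adm.root) ⟨c, (hCmem c).mpr (Reachable.refl _)⟩
    have h2 : ∀ v ∈ C, G.degIn (Finset.univ \ C) v ≤ if 0 < G.degIn B v then 1 else 0 := by
      intro v hv
      have h3 : G.degIn (Finset.univ \ C) v ≤ G.degIn B v := by
        refine Finset.card_le_card fun y hy => ?_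
        simp only [Finset.mem_filter, Finset.mem_sdiff, Finset.mem_univ, true_and] at hy ⊢
        refine ⟨?_, hy.2⟩
        by_contra hyB
        refine hy.1 ((hCmem y).mpr (((hCmem v).mp hv).trans ?_))
        exact Adj.reachable ⟨hy.2, by simpa using hCB v hv, by simpa using hyB⟩
      have := hone v (hCB v hv)
      split_ifs <;> omega
    have h3 := Finset.sum_le_sum h2
    rw [← Finset.card_filter] at h3
    obtain ⟨x, hx, y, hy, hxy⟩ := Finset.one_lt_card.mp
      (show 1 < (C.filter (fun v => 0 < G.degIn B v)).card by
        unfold cut crossing at h1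
        omega)
    obtain ⟨hxC, hxB⟩ := Finset.mem_filter.mp hx
    obtain ⟨hyC, hyB⟩ := Finset.mem_filter.mp hy
    obtain ⟨q, hq, hxq⟩ := degIn_pos_iff.mp hxB
    obtain ⟨q', hq', hyq⟩ := degIn_pos_iff.mp hyB
    exact hno x y ⟨hCB x hxC, hCB y hyC, hxy, ((hCmem x).mp hxC).symm.trans ((hCmem y).mp hyC),
      q, hq, q', hq', hxq, hyq, fun S hS => absurd hS (hex S)⟩

end Absorbing

end SimpleGraph

/-! ### Shortest ears and conclusion -/

namespace SimpleGraph

section Improving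

open scoped Classical

variable {V W : Type*} {G : SimpleGraph V} {T : SimpleGraph W} {k : ℕ} {r : V} {B : Finset V}
  [Fintype V]

/-- If the ear is shortest possible, then a vertex with three neighbours in `B` cannot be adjacent
to a later vertex of the ear: exchanging it with one of these neighbours would shorten the ear. -/
lemma Stuck.false_of_adj_ear (hB : T.Stuck G k r B)
    (hstuck : ∀ B', T.Optimal G k r B' → T.Stuck G k r B') {h : ℕ → V} {d : ℕ}
    (hmin : ∀ B' x y, T.Optimal G k r B' → G.EarPair k r B' x y → d ≤ (G.within B'ᶜ).dist x y)
    (hout : ∀ i ≤ d, h i ∉ B) (hadj : ∀ i < d, G.Adj (h i) (h (i + 1))) {q : V} (hq : q ∈ B)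
    (hdq : G.Adj (h d) q) {u a : V} (hu : u ∉ B) (ha : a ∈ B) (hua : G.Adj u a)
    (haq : ∀ S, G.Tight k r B S → a ∈ S → q ∉ S) (hdeg : 3 ≤ G.degIn B u) {i : ℕ} (hi : 1 ≤ i)
    (hid : i ≤ d) (hui : G.Adj u (h i)) (hne : ∀ j, i ≤ j → j ≤ d → u ≠ h j) : False := by
  obtain ⟨B', hB', huB', hqB', huq, hsub⟩ := hB.swap hu hdeg ha hua hq haq
  have hout' : ∀ j, i ≤ j → j ≤ d → h j ∈ B'ᶜ := fun j h1 h2 =>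
    hsub (Finset.mem_erase.mpr ⟨(hne j h1 h2).symm, by simpa using hout j h2⟩)
  have hyB' : h d ∉ B' := by simpa using hout' d hid le_rfl
  by_cases hw : h i = h d
  · obtain ⟨S, hS, hyS⟩ := (hstuck B' hB').exists_tight hyB'
      (two_le_degIn huB' hqB' (fun e => hu (e ▸ hq)) (hw ▸ hui.symm) hdq)
    exact huq S hS (hyS u huB' (hw ▸ hui.symm)) (hyS q hqB' hdq)
  · obtain ⟨p, hp⟩ := exists_walk_of_chain (K := G.within B'ᶜ) h hid fun j h1 h2 =>
      ⟨hadj j (by omega), hout' j h1 (by omega), hout' (j + 1) (by omega) (by omega)⟩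
    have h1 := hmin B' (h i) (h d) hB' ⟨by simpa using hout' i le_rfl hid, hyB', hw, ⟨p⟩,
      u, huB', q, hqB', hui.symm, hdq, huq⟩
    have h2 := dist_le p
    omega

/-- A vertex `u` off a shortest ear with a neighbour `a` in `B` that is not in a common tight set
with the attachment `q` of the last vertex of the ear has few neighbours in the enlarged set. -/
lemma Stuck.degIn_add_degIn_ear_le (hB : T.Stuck G k r B) (hk : 2 ≤ k)
    (hstuck : ∀ B', T.Optimal G k r B' → T.Stuck G k r B') {h : ℕ → V} {d : ℕ} (hd : 1 ≤ d)
    (hmin : ∀ B' x y, T.Optimal G k r B' → G.EarPair k r B' x y → d ≤ (G.within B'ᶜ).dist x y)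
    (hout : ∀ i ≤ d, h i ∉ B) (hadj : ∀ i < d, G.Adj (h i) (h (i + 1))) {q : V} (hq : q ∈ B)
    (hdq : G.Adj (h d) q) {u a : V} (hu : u ∉ B) (ha : a ∈ B) (hua : G.Adj u a)
    (haq : ∀ S, G.Tight k r B S → a ∈ S → q ∉ S) (hne : ∀ j ≤ d, u ≠ h j) :
    G.degIn B u + G.degIn ((Finset.range (d + 1)).image h) u ≤ k + 1 := by
  have hle : ∀ i ≤ d, G.Adj u (h i) → i ≤ 1 := by
    intro i hi hui
    obtain ⟨p, hp⟩ := exists_walk_of_chain (K := G.within Bᶜ) h hi fun j h1 h2 =>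
      ⟨hadj j (by omega), by simpa using hout j (by omega), by simpa using hout (j + 1) (by omega)⟩
    have hadj' : (G.within Bᶜ).Adj u (h i) := ⟨hui, by simpa using hu, by simpa using hout i hi⟩
    have h1 := hmin B u (h d) hB.toOptimal ⟨hu, hout d le_rfl, hne d le_rfl, ⟨p.cons hadj'⟩,
      a, ha, q, hq, hua, hdq, haq⟩
    have h2 := dist_le (p.cons hadj')
    rw [Walk.length_cons] at h2
    omega
  have hsub : ((Finset.range (d + 1)).image h).filter (G.Adj u) ⊆ {h 0, h 1} := by
    intro v hv
    obtain ⟨hv, huv⟩ := Finset.mem_filter.mp hv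
    obtain ⟨i, hi, rfl⟩ := Finset.mem_image.mp hv
    have := hle i (by rw [Finset.mem_range] at hi; omega) huv
    interval_cases i <;> simp
  have hP2 : G.degIn ((Finset.range (d + 1)).image h) u ≤ 2 :=
    (Finset.card_le_card hsub).trans Finset.card_le_two
  have hBk := hB.degIn_le u hu
  by_cases h1 : G.degIn B u ≤ 1
  · omega
  obtain ⟨S, hS, -⟩ := hB.exists_tight hu (by omega)
  have hk3 := hS.three
  by_cases h2 : G.degIn B u ≤ 2
  · omega
  have hna : ¬ G.Adj u (h 1) := fun e => hB.false_of_adj_ear hstuck hmin hout hadj hq hdq hu ha hua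
    haq (by omega) le_rfl hd e fun j _ => hne j
  have hP1 : G.degIn ((Finset.range (d + 1)).image h) u ≤ 1 := by
    refine (Finset.card_le_card (t := {h 0}) fun v hv => ?_).trans (by simp)
    have := hsub hv
    rw [Finset.mem_insert, Finset.mem_singleton] at this
    rcases this with rfl | rfl
    · simp
    · exact absurd (Finset.mem_filter.mp hv).2 hna
  omega

/-- A shortest ear improves an optimal set. -/
lemma Optimal.false_of_stuck [Fintype W] (hT : T.IsTree) (hk : 2 ≤ k)
    (hdeg : ∀ v, Fintype.card W + k ≤ G.degIn Finset.univ v)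
    (hcut : ∀ S : Finset V, r ∉ S → S.Nonempty → k ≤ G.cut Finset.univ S)
    (hstuck : ∀ B', T.Optimal G k r B' → T.Stuck G k r B') {B0 : Finset V}
    (hB0 : T.Optimal G k r B0) : False := by
  have : Nonempty W := hT.connected.nonempty
  have hex : ∃ n B x y, T.Optimal G k r B ∧ G.EarPair k r B x y ∧ (G.within Bᶜ).dist x y = n := by
    obtain ⟨f, -, -, hf⟩ := hB0.fits
    obtain ⟨x, y, hxy⟩ := (hstuck B0 hB0).exists_earPair hk hcut
      (by simpa using hf (Classical.arbitrary W))
    exact ⟨_, B0, x, y, hB0, hxy, rfl⟩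
  obtain ⟨B, x, y, hBo, hxy, hdist⟩ := Nat.find_spec hex
  have hmin : ∀ B' x y, T.Optimal G k r B' → G.EarPair k r B' x y →
      Nat.find hex ≤ (G.within B'ᶜ).dist x y := fun B' x y h1 h2 =>
    Nat.find_min' hex ⟨B', x, y, h1, h2, rfl⟩
  set d := Nat.find hex
  clear_value d
  have hB := hstuck B hBo
  set K := G.within Bᶜ with hK
  have hd : 1 ≤ d := hdist ▸ hxy.reach.pos_dist_of_ne hxy.ne
  obtain ⟨p, hp⟩ := hxy.reach.exists_walk_length_eq_dist
  rw [hdist] at hp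
  obtain ⟨h, hh⟩ : ∃ h : ℕ → V, h = p.getVert := ⟨_, rfl⟩
  have hx : h 0 = x := by rw [hh, Walk.getVert_zero]
  have hy : h d = y := by rw [hh, ← hp, Walk.getVert_length]
  have hKadj : ∀ i < d, K.Adj (h i) (h (i + 1)) := fun i hi => by
    rw [hh]
    exact p.adj_getVert_succ (by omega)
  have hadj : ∀ i < d, G.Adj (h i) (h (i + 1)) := fun i hi => (hKadj i hi).1
  have hout : ∀ i ≤ d, h i ∉ B := by
    intro i hi
    rcases Nat.lt_or_ge i d with h1 | h1
    · simpa using (hKadj i h1).2.1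
    · rw [le_antisymm hi h1, hy]
      exact hxy.right
  -- `h` is a geodesic
  have hgeo : ∀ i ≤ d, ∀ j ≤ d, K.Reachable (h i) (h j) → j ≤ i + K.dist (h i) (h j) := by
    intro i hi j hj hr
    obtain ⟨p1, hp1⟩ := exists_walk_of_chain (K := K) h (Nat.zero_le i) fun j _ h2 => hKadj j (by omega)
    obtain ⟨p2, hp2⟩ := exists_walk_of_chain (K := K) h hj fun j _ h2 => hKadj j (by omega)
    obtain ⟨p3, hp3⟩ := hr.exists_walk_length_eq_dist
    have h1 := dist_le ((p1.append p3).append p2)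
    rw [Walk.length_append, Walk.length_append] at h1
    have h2 : K.dist (h 0) (h d) = d := by rw [hx, hy, hdist]
    omega
  have hinj : ∀ i ≤ d, ∀ j ≤ d, h i = h j → i = j := by
    intro i hi j hj e
    have h1 := hgeo i hi j hj (e ▸ Reachable.refl _)
    have h2 := hgeo j hj i hi (e ▸ Reachable.refl _)
    rw [e, dist_self] at h1
    rw [e, dist_self] at h2
    omega
  have hchord : ∀ i ≤ d, ∀ j ≤ d, G.Adj (h i) (h j) → i + 1 = j ∨ j + 1 = i := by
    intro i hi j hj e
    have e' : K.Adj (h i) (h j) := ⟨e, by simpa using hout i hi, by simpa using hout j hj⟩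
    have h1 := hgeo i hi j hj e'.reachable
    have h2 := hgeo j hj i hi e'.symm.reachable
    rw [dist_eq_one_iff_adj.mpr e'] at h1
    rw [dist_eq_one_iff_adj.mpr e'.symm] at h2
    have h3 : i ≠ j := fun e'' => G.loopless.irrefl _ (e'' ▸ e)
    omega
  obtain ⟨q, hq, q', hq', hxq, hyq, hqq⟩ := hxy.ends
  rw [← hx] at hxq
  rw [← hy] at hyq
  obtain ⟨hadm, hexc⟩ := hB.adm.union_path hd hout hinj hadj hchord hq hq' hxq hyq hqq
  set P := (Finset.range (d + 1)).image h with hP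
  have hPmem : ∀ v, v ∈ P ↔ ∃ i ≤ d, h i = v := by
    intro v
    simp [hP]
  have hBP : Disjoint B P := by
    rw [Finset.disjoint_right]
    intro v hv
    obtain ⟨i, hi, rfl⟩ := (hPmem v).mp hv
    exact hout i hi
  have hfew : ∀ u, u ∉ B → u ∉ P → G.degIn (B ∪ P) u ≤ k + 1 := by
    intro u hu huP
    have hne : ∀ j ≤ d, u ≠ h j := fun j hj e => huP ((hPmem u).mpr ⟨j, hj, e.symm⟩)
    rw [degIn_union hBP]
    by_cases h0 : G.degIn B u = 0
    · have h3 : G.degIn P u ≤ 3 := by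
        by_cases hJ : ∃ i, i ≤ d ∧ G.Adj u (h i)
        · have hi := Nat.find_spec hJ
          have him : ∀ j, j ≤ d → G.Adj u (h j) → Nat.find hJ ≤ j := fun j h1 h2 =>
            Nat.find_min' hJ ⟨h1, h2⟩
          set i := Nat.find hJ
          clear_value i
          have hsub : P.filter (G.Adj u) ⊆ {h i, h (i + 1), h (i + 2)} := by
            intro v hv
            obtain ⟨hv, huv⟩ := Finset.mem_filter.mp hv
            obtain ⟨j, hj, rfl⟩ := (hPmem v).mp hv
            have h1 := him j hj huv
            have hKu : ∀ l ≤ d, G.Adj u (h l) → K.Adj u (h l) := fun l hl e =>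
              ⟨e, by simpa using hu, by simpa using hout l hl⟩
            have w : K.Walk (h i) (h j) :=
              Walk.cons (hKu i hi.1 hi.2).symm (Walk.cons (hKu j hj huv) Walk.nil)
            have h2 := hgeo i hi.1 j hj ⟨w⟩
            have h3 : K.dist (h i) (h j) ≤ 2 :=
              dist_le (Walk.cons (hKu i hi.1 hi.2).symm (Walk.cons (hKu j hj huv) Walk.nil))
            obtain rfl | rfl | rfl : j = i ∨ j = i + 1 ∨ j = i + 2 := by omega
            all_goals simp
          exact (Finset.card_le_card hsub).trans Finset.card_le_three
        · push Not at hJ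
          have : G.degIn P u = 0 := degIn_eq_zero_iff.mpr fun v hv => by
            obtain ⟨j, hj, rfl⟩ := (hPmem v).mp hv
            exact hJ j hj
          omega
      omega
    · obtain ⟨a, ha, hua⟩ := degIn_pos_iff.mp (Nat.pos_of_ne_zero h0)
      by_cases haq : ∀ S, G.Tight k r B S → a ∈ S → q' ∉ S
      · exact hB.degIn_add_degIn_ear_le hk hstuck hd hmin hout hadj hq' hyq hu ha hua haq hne
      · -- otherwise `a` and `q` are in no common tight set, and the ear is read backwards
        push Not at haq
        obtain ⟨S', hS', haS', hqS'⟩ := haq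
        have haq : ∀ S, G.Tight k r B S → a ∈ S → q ∉ S := fun S hS haS hqS =>
          hqq _ (hB.adm.tight_union hS hS' ⟨a, Finset.mem_inter.mpr ⟨haS, haS'⟩⟩)
            (Finset.mem_union_left _ hqS) (Finset.mem_union_right _ hqS')
        have hrev : P = (Finset.range (d + 1)).image (fun i => h (d - i)) := by
          ext v
          rw [hPmem]
          simp only [Finset.mem_image, Finset.mem_range, Nat.lt_succ_iff]
          constructor
          · rintro ⟨i, hi, rfl⟩
            exact ⟨d - i, by omega, by rw [Nat.sub_sub_self hi]⟩
          · rintro ⟨i, hi, rfl⟩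
            exact ⟨d - i, by omega, rfl⟩
        rw [hrev]
        refine hB.degIn_add_degIn_ear_le hk hstuck hd hmin (fun i _ => hout _ (by omega)) ?_ hq
          (by simpa using hxq) hu ha hua haq (fun j _ => hne _ (by omega))
        intro i hi
        have := hadj (d - (i + 1)) (by omega)
        rw [show d - (i + 1) + 1 = d - i by omega] at this
        exact this.symm
  have hend : G.degIn B (h 0) + 1 ≤ k := by
    have h1 := hB.degIn_le (h 0) (hout 0 (by omega))
    by_contra hcon
    obtain ⟨S, hS, -⟩ := hB.exists_tight (hout 0 (by omega)) (by omega)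
    have hk3 := hS.three
    refine hB.false_of_adj_ear hstuck hmin hout hadj hq' hyq (hout 0 (by omega)) hq hxq hqq
      (by omega) le_rfl hd (hadj 0 (by omega)) fun j h1 h2 e => ?_
    have := hinj 0 (by omega) j h2 e
    omega
  have hcompl : ∀ v, G.degIn (B ∪ P) v + G.degIn (B ∪ P)ᶜ v = G.degIn Finset.univ v :=
    degIn_add_degIn_compl (B ∪ P)
  have hfit : T.FitsIn G (B ∪ P)ᶜ := by
    refine hT.fitsIn_of_degIn ?_ fun v hv => ?_
    · have h1 : G.degIn P (h 0) ≤ 1 := by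
        refine (Finset.card_le_card (t := {h 1}) fun v hv => ?_).trans (by simp)
        obtain ⟨hv, h0v⟩ := Finset.mem_filter.mp hv
        obtain ⟨j, hj, rfl⟩ := (hPmem v).mp hv
        have := hchord 0 (by omega) j hj h0v
        obtain rfl : j = 1 := by omega
        simp
      have h2 := hcompl (h 0)
      rw [degIn_union hBP] at h2
      have h3 := hdeg (h 0)
      have h4 : 0 < Fintype.card W := Fintype.card_pos
      obtain ⟨v, hv, -⟩ := degIn_pos_iff.mp (show 0 < G.degIn (B ∪ P)ᶜ (h 0) by omega)
      exact ⟨v, hv⟩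
    · simp only [Finset.mem_compl, Finset.mem_union, not_or] at hv
      have h1 := hfew v hv.1 hv.2
      have h2 := hcompl v
      have h3 := hdeg v
      omega
  exact absurd (hBo.excess_le _ ⟨hadm, hfit⟩) (not_le.mpr hexc)

/-- If all cuts of `G` have at least `k` edges, then there is a copy of `T` whose removal leaves a
graph with the same property.  The minimum degree excludes small tight sets as soon as the
complement of an optimal set is just a copy of `T`. -/
lemma IsTree.exists_copy_cut_le [Fintype W] (hT : T.IsTree) (hk : k = 2 ∨ k = 3)
    (hdeg : ∀ v, Fintype.card W + k ≤ G.degIn Finset.univ v) (r : V)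
    (hcut : ∀ S : Finset V, r ∉ S → S.Nonempty → k ≤ G.cut Finset.univ S) :
    ∃ f : W → V, Function.Injective f ∧ (∀ a b, T.Adj a b → G.Adj (f a) (f b)) ∧
      ∃ r ∉ Finset.univ.image f, ∀ S ⊆ (Finset.univ.image f)ᶜ, r ∉ S → S.Nonempty →
        k ≤ G.cut (Finset.univ.image f)ᶜ S := by
  have hk2 : 2 ≤ k := by omega
  have hroomy : T.Roomy G k r {r} := by
    have hle : ∀ v, Fintype.card W + k ≤ G.degIn {r}ᶜ v + 1 := fun v => by
      have h1 := hdeg v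
      have h2 := degIn_add_degIn_compl (G := G) {r} v
      have h3 := degIn_le_card (G := G) {r} v
      rw [Finset.card_singleton] at h3
      omega
    refine ⟨Admissible.singleton k r, hT.fitsIn_of_degIn ?_ fun v _ => ?_⟩
    · have := hle r
      obtain ⟨v, hv, -⟩ := degIn_pos_iff.mp (show 0 < G.degIn {r}ᶜ r by omega)
      exact ⟨v, hv⟩
    · have := hle v
      omega
  obtain ⟨B0, hB0⟩ := exists_optimal ⟨_, hroomy⟩
  by_cases hdone : ∃ B, T.Optimal G k r B ∧ ∃ f : W → V, Function.Injective f ∧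
      (∀ a b, T.Adj a b → G.Adj (f a) (f b)) ∧ (∀ w, f w ∉ B) ∧ ∀ c ∉ B, ∃ w, f w = c
  · obtain ⟨B, hB, f, hinj, hhom, hfB, hcov⟩ := hdone
    have hBf : (Finset.univ.image f)ᶜ = B := by
      ext v
      simp only [Finset.mem_compl, Finset.mem_image, Finset.mem_univ, true_and]
      constructor
      · intro h
        by_contra hv
        exact h (hcov v hv)
      · rintro hv ⟨w, rfl⟩
        exact hfB w hv
    refine ⟨f, hinj, hhom, r, by rw [← Finset.mem_compl, hBf]; exact hB.adm.root, ?_⟩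
    rw [hBf]
    intro S hS hr hne
    have h2 := hB.adm.two_le S hS hr hne
    by_contra hcon
    -- a vertex of a tight set would have degree two in `G[B]`
    obtain ⟨v, hv⟩ := hne
    have h3 := hB.adm.degIn_eq S ⟨by omega, hS, hr, ⟨v, hv⟩, by omega⟩ v hv
    have h4 := hdeg v
    have h5 := degIn_add_degIn_compl (G := G) B v
    have h6 := degIn_le_card (G := G) Bᶜ v
    have h7 : Bᶜ.card = Fintype.card W := by
      rw [← hBf, compl_compl, Finset.card_image_of_injective _ hinj, Finset.card_univ]
    omega
  · push Not at hdone
    exact (Optimal.false_of_stuck hT hk2 hdeg hcut (fun B hB =>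
      hB.stuck hT hk2 hdeg fun f h1 h2 h3 => hdone B hB f h1 h2 h3) hB0).elim

end Improving

section EdgeConnectivity

open scoped Classical

variable {V : Type*} {G : SimpleGraph V} {k : ℕ}

/-- Edge-connectivity bounds the cuts of vertex sets from below. -/
lemma IsKEdgeConnected.le_cut [Fintype V] (h : G.IsKEdgeConnected k) (hk : 2 ≤ k) {r : V}
    {S : Finset V} (hr : r ∉ S) (hS : S.Nonempty) : k ≤ G.cut Finset.univ S := by
  unfold IsKEdgeConnected edgeConnectivity at h
  split_ifs at h with h1
  · omega
  set E := ((S ×ˢ (Finset.univ \ S)).filter (fun p => G.Adj p.1 p.2)).image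
    (fun p => s(p.1, p.2)) with hE
  have hEmem : ∀ a b, G.Adj a b → a ∈ S → b ∉ S → s(a, b) ∈ E := by
    intro a b hab ha hb
    exact Finset.mem_image.mpr ⟨(a, b), by simp [ha, hb, hab], rfl⟩
  have hsub : (E : Set (Sym2 V)) ⊆ G.edgeSet := by
    intro e he
    obtain ⟨p, hp, rfl⟩ := Finset.mem_image.mp he
    exact (Finset.mem_filter.mp hp).2
  have hdis : ¬ (G.deleteEdges (E : Set (Sym2 V))).Connected := by
    intro hc
    obtain ⟨s, hs⟩ := hS
    obtain ⟨p⟩ := hc.preconnected s r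
    have hstay : ∀ a b, (p : (G.deleteEdges (E : Set (Sym2 V))).Walk a b) → a ∈ S → b ∈ S := by
      intro a b p
      induction p with
      | nil => exact id
      | cons hadj _ ih =>
        intro ha
        refine ih ?_
        by_contra hb
        rw [deleteEdges_adj] at hadj
        exact hadj.2 (hEmem _ _ hadj.1 ha hb)
    exact hr (hstay s r p hs)
  have h2 : k ≤ E.card := h.trans (Nat.sInf_le ⟨E, hsub, hdis, rfl⟩)
  refine h2.trans (Finset.card_image_le.trans ?_)
  unfold cut crossing degIn
  rw [Finset.card_filter, Finset.sum_product]
  simp only [Finset.card_filter]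
  exact le_rfl

/-- A lower bound on the cuts of vertex sets of an induced subgraph bounds its edge-connectivity
from below. -/
lemma isKEdgeConnected_induce {A : Set V} {B : Finset V} (hAB : A = B) {r : V} (hr : r ∈ B)
    (hcard : 2 ≤ B.card) (h : ∀ S ⊆ B, r ∉ S → S.Nonempty → k ≤ G.cut B S) :
    (G.induce A).IsKEdgeConnected k := by
  subst hAB
  unfold IsKEdgeConnected edgeConnectivity
  have hc1 : Nat.card (B : Set V) ≠ 1 := by
    rw [Nat.card_eq_fintype_card]
    simp only [Finset.coe_sort_coe, Fintype.card_coe]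
    omega
  rw [if_neg hc1]
  have hne : Nonempty (B : Set V) := ⟨⟨r, hr⟩⟩
  refine le_csInf ⟨_, ((B.attach ×ˢ B.attach).image fun p => s(p.1, p.2)).filter
    (fun e => e ∈ (G.induce (B : Set V)).edgeSet), ?_, ?_, rfl⟩ ?_
  · intro e he
    exact (Finset.mem_filter.mp he).2
  · intro hc
    obtain ⟨a, ha, b, hb, hab⟩ := Finset.one_lt_card.mp (show 1 < B.card by omega)
    obtain ⟨p⟩ := hc.preconnected ⟨a, ha⟩ ⟨b, hb⟩
    cases p with
    | nil => exact hab rfl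
    | cons hadj _ =>
      rw [deleteEdges_adj] at hadj
      refine hadj.2 ?_
      rw [Finset.mem_coe, Finset.mem_filter]
      exact ⟨Finset.mem_image.mpr ⟨(_, _), by simp, rfl⟩, hadj.1⟩
  · rintro n ⟨U, hU, hdis, rfl⟩
    set D := (G.induce (B : Set V)).deleteEdges (U : Set (Sym2 (B : Set V))) with hD
    -- the vertices not connected to the root
    obtain ⟨x, hx⟩ : ∃ x, ¬ D.Reachable ⟨r, hr⟩ x := by
      by_contra hcon
      push Not at hcon
      exact hdis ⟨fun a b => (hcon a).symm.trans (hcon b)⟩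
    set S := B.filter (fun v => ∃ hv : v ∈ B, ¬ D.Reachable ⟨r, hr⟩ ⟨v, hv⟩) with hS
    have hSmem : ∀ v, v ∈ S ↔ ∃ hv : v ∈ B, ¬ D.Reachable ⟨r, hr⟩ ⟨v, hv⟩ := by
      intro v
      rw [hS, Finset.mem_filter]
      exact ⟨fun h => h.2, fun h => ⟨h.1, h⟩⟩
    refine (h S (Finset.filter_subset _ _) (fun hrS => ?_) ⟨x.1, (hSmem _).mpr ⟨x.2, hx⟩⟩).trans ?_
    · obtain ⟨_, h1⟩ := (hSmem r).mp hrS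
      exact h1 (Reachable.refl _)
    · have hcut : G.cut B S = ((S ×ˢ (B \ S)).filter (fun p => G.Adj p.1 p.2)).card := by
        unfold cut crossing degIn
        rw [Finset.card_filter, Finset.sum_product]
        simp only [Finset.card_filter]
      rw [hcut, ← Finset.card_image_of_injective U (Sym2.map.injective Subtype.val_injective)]
      refine Finset.card_le_card_of_injOn (fun p => s(p.1, p.2)) ?_ ?_
      · rintro ⟨a, b⟩ hab
        simp only [Finset.coe_filter, Finset.mem_product, Finset.mem_sdiff,
          Set.mem_ofPred_eq] at hab
        obtain ⟨⟨haS, hbB, hbS⟩, hadj⟩ := hab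
        obtain ⟨haB, hra⟩ := (hSmem a).mp haS
        have hrb : D.Reachable ⟨r, hr⟩ ⟨b, hbB⟩ := by
          by_contra hcon
          exact hbS ((hSmem b).mpr ⟨hbB, hcon⟩)
        have hmem : s((⟨a, haB⟩ : (B : Set V)), ⟨b, hbB⟩) ∈ U := by
          by_contra hcon
          refine hra (hrb.trans (Adj.reachable ?_))
          rw [hD, deleteEdges_adj]
          refine ⟨hadj.symm, ?_⟩
          rw [Sym2.eq_swap]
          exact hcon
        exact Finset.mem_coe.mpr (Finset.mem_image.mpr ⟨_, hmem, rfl⟩)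
      · rintro ⟨a, b⟩ hab ⟨a', b'⟩ hab' he
        simp only [Finset.coe_filter, Finset.mem_product, Finset.mem_sdiff,
          Set.mem_ofPred_eq] at hab hab'
        rcases Sym2.eq_iff.mp he with ⟨rfl, rfl⟩ | ⟨rfl, rfl⟩
        · rfl
        · exact absurd hab.1.1 hab'.1.2.2

end EdgeConnectivity

end SimpleGraph

open scoped Classical in
/-- Passage from cuts of vertex sets to edge-connectivity.  At least two vertices remain outside the
copy of `T`, so that the convention for graphs with one vertex plays no role. -/
lemma SimpleGraph.IsTree.exists_subgraph_minusVerts {V W : Type*} [Fintype V] [Fintype W]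
    {T : SimpleGraph W} (hT : T.IsTree) {G : SimpleGraph V} {k : ℕ} (hk : k = 2 ∨ k = 3)
    (hG : G.IsKEdgeConnected k) (hdeg : ∀ v, Fintype.card W + k ≤ G.degIn Finset.univ v) :
    ∃ T' : G.Subgraph, Nonempty (T'.coe ≃g T) ∧ (G.minusVerts T').IsKEdgeConnected k := by
  have hne : Nonempty V := by
    by_contra hemp
    rw [not_nonempty_iff] at hemp
    have h0 : G.edgeConnectivity = 0 := by
      unfold edgeConnectivity
      rw [if_neg (by simp)]
      refine Nat.sInf_eq_zero.mpr (Or.inl ⟨∅, by simp, fun h => ?_, rfl⟩)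
      exact h.nonempty.elim hemp.false
    unfold IsKEdgeConnected at hG
    omega
  obtain ⟨f, hinj, hhom, r, hr, hcut⟩ := hT.exists_copy_cut_le hk hdeg
    (Classical.arbitrary V) fun S h1 h2 => hG.le_cut (by omega) h1 h2
  let c : T.Copy G := ⟨⟨f, fun {a b} h => hhom a b h⟩, hinj⟩
  have hverts : c.toSubgraph.vertsᶜ = (((Finset.univ.image f)ᶜ : Finset V) : Set V) := by
    ext v
    simp [c]
  refine ⟨c.toSubgraph, ⟨c.isoToSubgraph.symm⟩, isKEdgeConnected_induce hverts
    (Finset.mem_compl.mpr hr) ?_ hcut⟩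
  have h1 := hdeg r
  have h2 := degIn_le_card (G := G) Finset.univ r
  have h3 := Finset.card_add_card_compl (Finset.univ.image f)
  rw [Finset.card_image_of_injective _ hinj, Finset.card_univ] at h3
  rw [Finset.card_univ] at h2
  omega

theorem theorem4p4 {V W : Type*} [Fintype V] [Fintype W]
    (m : ℕ) (T : SimpleGraph W) (hT : T.IsTree) (hm : Fintype.card W = m)
    (G : SimpleGraph V) [DecidableRel G.Adj] :
    (G.IsKEdgeConnected 2 → m + 2 ≤ G.minDegree →
      ∃ T' : G.Subgraph, Nonempty (T'.coe ≃g T) ∧ (G.minusVerts T').IsKEdgeConnected 2) ∧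
    (G.IsKEdgeConnected 3 → m + 3 ≤ G.minDegree →
      ∃ T' : G.Subgraph, Nonempty (T'.coe ≃g T) ∧ (G.minusVerts T').IsKEdgeConnected 3) := by
  have hdeg : ∀ k, m + k ≤ G.minDegree → ∀ v, Fintype.card W + k ≤ G.degIn Finset.univ v := by
    intro k hk v
    rw [hm]
    refine hk.trans ((G.minDegree_le_degree v).trans (le_of_eq ?_))
    unfold SimpleGraph.degIn
    rw [← SimpleGraph.card_neighborFinset_eq_degree, SimpleGraph.neighborFinset_eq_filter]
    congr
  exact ⟨fun hG hd => hT.exists_subgraph_minusVerts (Or.inl rfl) hG (hdeg 2 hd),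
    fun hG hd => hT.exists_subgraph_minusVerts (Or.inr rfl) hG (hdeg 3 hd)⟩
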